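/- For a positive integer $n$ let $d_4(n)$ be the number of ordered quadruples of positive integers with product $n$. Let $\gamma$ be Euler's constant and let $$\gamma_k=\lim_{N\to\infty}\left(\sum_{m\le N}\frac{(\log m)^k}{m}-\frac{(\log N)^{k+1}}{k+1}\right)$$ be the Stieltjes constants. Put $$C_1=\frac16,\qquad C_2=2\gamma-\frac12,\qquad C_3=6\gamma^2-4\gamma-4\gamma_1+1,$$ $$C_4=4\gamma^3-6\gamma^2+4\gamma-12\gamma\gamma_1+4\gamma_1+2\gamma_2-1.$$ Then $0.654\le C_2<0.655$, $0.981\le C_3<0.982$, $0.272\le C_4<0.273$, and for every real $x\ge 2$ $$\left|\sum_{n\le x}d_4(n)-\left(C_1x\log^3x+C_2x\log^2x+C_3x\log x+C_4x\right)\right|\le 4.48\,x^{3/4}\log x .$$ Furthermore, for every real $x\ge 193$, $$\sum_{n\le x}d_4(n)\le\frac13\,x\log^3x .$$ -/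

import Mathlib

/-- `dk k n` is the number of ordered `k`-tuples of positive integers whose product is `n`
(and `dk k 0 = 0`). -/
def dk (k n : ℕ) : ℕ := (Nat.finMulAntidiag k n).card

/-- `sumDk k x` is the sum of `dk k n` over the integers `1 ≤ n ≤ x`. -/
noncomputable def sumDk (k : ℕ) (x : ℝ) : ℝ := ∑ n ∈ Finset.Icc 1 ⌊x⌋₊, (dk k n : ℝ)

/-- The `n`-th Stieltjes constant
`γₙ = lim_{N → ∞} (∑_{m ≤ N} (log m) ^ n / m - (log N) ^ (n + 1) / (n + 1))`,
so that `ζ(s) = 1 / (s - 1) + ∑ₙ (-1) ^ n γₙ (s - 1) ^ n / n!`. -/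
noncomputable def stieltjesConstant (n : ℕ) : ℝ :=
  Filter.limUnder Filter.atTop (fun N : ℕ =>
    (∑ m ∈ Finset.Icc 1 N, Real.log m ^ n / m) - Real.log N ^ (n + 1) / (n + 1))

/-- Coefficient of `x (log x) ^ 3`. -/
noncomputable def C₁ : ℝ := 1 / 6

/-- Coefficient of `x (log x) ^ 2`. -/
noncomputable def C₂ : ℝ := 2 * Real.eulerMascheroniConstant - 1 / 2

/-- Coefficient of `x log x`. -/
noncomputable def C₃ : ℝ :=
  6 * Real.eulerMascheroniConstant ^ 2 - 4 * Real.eulerMascheroniConstant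
    - 4 * stieltjesConstant 1 + 1

/-- Coefficient of `x`. -/
noncomputable def C₄ : ℝ :=
  4 * Real.eulerMascheroniConstant ^ 3 - 6 * Real.eulerMascheroniConstant ^ 2
    + 4 * Real.eulerMascheroniConstant
    - 12 * Real.eulerMascheroniConstant * stieltjesConstant 1
    + 4 * stieltjesConstant 1 + 2 * stieltjesConstant 2 - 1

/-! Since `d₄ = τ * τ` with `τ = d₂`, the hyperbola method gives `∑_{n ≤ x} d₄(n) = 2 ∑_{a ≤ √x}
τ(a) D(x/a) - D(√x)²`, where `D(t) = t log t + (2γ - 1) t + Δ(t)` is the summatory function of `τ`.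
The main analytic input is the elementary bound `|Δ(t)| ≤ √t + 1/4` (`abs_divErr_le`).

Abel summation evaluates `∑ τ(a)/a` and `∑ τ(a) log a / a` exactly in terms of `∫ Δ(t)/t²` and `∫
Δ(t) log t / t²`. The terms linear in `Δ(√x)` cancel against those of `D(√x)²`. Extending the
integrals from `√x` to infinity leaves `x` times a cubic in `log x` (`sumDk_four_eq_main_add`). Two
errors dominate, `2 ∑ τ(a) Δ(x/a)` and the tail of the integrals. Each is at most `2 x^{3/4} (log x
+ 4γ - 4)` up to `O(√x log x)`, so the leading constant is 4, and 4.48 suffices from `x = 112` on.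

The coefficients of the cubic involve the full integrals. These are found by evaluating the same two
sums a second time, with the hyperbola method for `(1/n) * (1/n)` and `(1/n) * (log n / n)`, which
brings in `γ`, `γ₁`, `γ₂` (`tendsto_divErrInt`, `tendsto_divErrLogInt_sub`). Euler-Maclaurin
summation at `N = 10` encloses these constants numerically.

For `x < 112` the estimate is a finite check on short intervals, using exact values of the summatory
function. The last inequality follows from the first for `x ≥ 408` and is another finite check on
`[193, 408)`. -/

/-! ### Dirichlet convolution and the hyperbola method -/

theorem dk_succ (k n : ℕ) :
    dk (k + 1) n = ∑ p ∈ n.divisorsAntidiagonal, dk k p.2 := by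
  unfold dk
  rw [← Finset.card_sigma]
  refine Finset.card_nbij' (fun f => ⟨(f 0, ∏ i, Fin.tail f i), Fin.tail f⟩)
    (fun s => Fin.cons s.1.1 s.2) ?_ ?_ ?_ ?_
  · intro f hf
    simp only [Finset.mem_coe, Nat.mem_finMulAntidiag, Fin.prod_univ_succ] at hf
    obtain ⟨h1, h2⟩ := hf
    have h3 : (∏ i, Fin.tail f i) ≠ 0 := by
      intro h
      apply h2
      rw [← h1]
      simp only [Fin.tail] at h
      rw [h, mul_zero]
    simp only [Finset.mem_coe, Finset.mem_sigma, Nat.mem_divisorsAntidiagonal,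
      Nat.mem_finMulAntidiag]
    exact ⟨⟨h1, h2⟩, trivial, h3⟩
  · rintro ⟨⟨a, b⟩, g⟩ hs
    simp only [Finset.mem_coe, Finset.mem_sigma, Nat.mem_divisorsAntidiagonal,
      Nat.mem_finMulAntidiag] at hs
    simp only [Finset.mem_coe, Nat.mem_finMulAntidiag, Fin.prod_univ_succ, Fin.cons_zero,
      Fin.cons_succ]
    exact ⟨by rw [hs.2.1]; exact hs.1.1, hs.1.2⟩
  · intro f _
    simp
  · rintro ⟨⟨a, b⟩, g⟩ hs
    simp only [Finset.mem_coe, Finset.mem_sigma, Nat.mem_divisorsAntidiagonal,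
      Nat.mem_finMulAntidiag] at hs
    obtain ⟨-, rfl, -⟩ := hs
    simp

open ArithmeticFunction in
theorem dk_eq_zeta_pow (k n : ℕ) : dk k n = (zeta ^ k : ArithmeticFunction ℕ) n := by
  induction k generalizing n with
  | zero =>
    rw [pow_zero, one_apply, dk]
    split_ifs with h
    · simp [h, Nat.finMulAntidiag_one]
    · simp [Nat.finMulAntidiag_zero_left h]
  | succ k ih =>
    rw [dk_succ, pow_succ', mul_apply]
    refine Finset.sum_congr rfl fun p hp => ?_
    have : p.1 ≠ 0 := (Nat.mem_divisorsAntidiagonal.1 hp |> fun h h0 => h.2 (by simp [← h.1, h0]))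
    simp [ih, this]

/-- The divisor function with real values. -/
noncomputable def tau : ArithmeticFunction ℝ :=
  (ArithmeticFunction.zeta : ArithmeticFunction ℝ) * (ArithmeticFunction.zeta : ArithmeticFunction ℝ)

/-- The summatory function of the divisor function. -/
noncomputable def divSum (x : ℝ) : ℝ := ∑ n ∈ Finset.Ioc 0 ⌊x⌋₊, tau n

theorem zeta_real_apply {n : ℕ} (hn : n ≠ 0) :
    (ArithmeticFunction.zeta : ArithmeticFunction ℝ) n = 1 := by
  simp [hn]

theorem tau_nonneg (n : ℕ) : 0 ≤ tau n := by
  unfold tau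
  rw [ArithmeticFunction.mul_apply]
  refine Finset.sum_nonneg fun p _ => ?_
  simp only [ArithmeticFunction.natCoe_apply]
  positivity

theorem sumDk_eq_sum_zeta_pow (k : ℕ) (x : ℝ) :
    sumDk k x = ((∑ n ∈ Finset.Ioc 0 ⌊x⌋₊, (ArithmeticFunction.zeta ^ k : ArithmeticFunction ℕ) n : ℕ) : ℝ) := by
  unfold sumDk
  push_cast
  refine Finset.sum_congr (by ext; simp [Nat.succ_le_iff]) fun n _ => ?_
  rw [dk_eq_zeta_pow]

theorem sumDk_four_eq (x : ℝ) : sumDk 4 x = ∑ n ∈ Finset.Ioc 0 ⌊x⌋₊, (tau * tau) n := by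
  rw [sumDk_eq_sum_zeta_pow]
  push_cast
  refine Finset.sum_congr rfl fun n _ => ?_
  rw [← ArithmeticFunction.natCoe_apply (R := ℝ)]
  congr 1
  rw [show (4 : ℕ) = 2 + 2 from rfl, pow_add, sq]
  simp [tau, ArithmeticFunction.natCoe_mul]

/-- Dirichlet's hyperbola method. -/
theorem sum_Ioc_mul_hyperbola (f g : ArithmeticFunction ℝ) {M N : ℕ} (h1 : M * M ≤ N)
    (h2 : N < (M + 1) * (M + 1)) :
    ∑ n ∈ Finset.Ioc 0 N, (f * g) n =
      ∑ a ∈ Finset.Ioc 0 M, f a * ∑ b ∈ Finset.Ioc 0 (N / a), g b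
      + ∑ b ∈ Finset.Ioc 0 M, g b * ∑ a ∈ Finset.Ioc 0 (N / b), f a
      - (∑ a ∈ Finset.Ioc 0 M, f a) * ∑ b ∈ Finset.Ioc 0 M, g b := by
  have hMN : M ≤ N := by nlinarith [Nat.zero_le M, Nat.le_mul_self M]
  have key : ∀ h : ℕ → ℕ → ℝ, ∑ a ∈ Finset.Ioc 0 M, ∑ b ∈ Finset.Ioc 0 (N / a), h a b =
      ∑ x ∈ Finset.Ioc 0 N ×ˢ Finset.Ioc 0 N, if x.1 * x.2 ≤ N ∧ x.1 ≤ M then h x.1 x.2 else 0 := by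
    intro h
    rw [Finset.sum_product]
    rw [← Finset.sum_subset (Finset.Ioc_subset_Ioc_right hMN)]
    · refine Finset.sum_congr rfl fun a ha => ?_
      rw [← Finset.sum_filter]
      refine Finset.sum_congr ?_ fun _ _ => rfl
      ext b
      simp only [Finset.mem_Ioc, Finset.mem_filter] at ha ⊢
      rw [Nat.le_div_iff_mul_le ha.1]
      constructor
      · rintro ⟨hb, hab⟩
        exact ⟨⟨hb, by nlinarith⟩, by nlinarith, ha.2⟩
      · rintro ⟨hb, hab, -⟩
        exact ⟨hb.1, by nlinarith⟩
    · intro a _ ha2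
      refine Finset.sum_eq_zero fun b _ => if_neg ?_
      simp only [Finset.mem_Ioc, not_and] at ha2
      intro h
      simp_all
  have e1 := key fun a b => f a * g b
  have e2 := key fun a b => g a * f b
  simp only [← Finset.mul_sum] at e1 e2
  have e3 : ∑ x ∈ Finset.Ioc 0 N ×ˢ Finset.Ioc 0 N,
      (if x.1 * x.2 ≤ N ∧ x.1 ≤ M then g x.1 * f x.2 else 0) =
      ∑ x ∈ Finset.Ioc 0 N ×ˢ Finset.Ioc 0 N,
      if x.1 * x.2 ≤ N ∧ x.2 ≤ M then f x.1 * g x.2 else 0 := by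
    rw [Finset.sum_product, Finset.sum_product_right]
    refine Finset.sum_congr rfl fun a _ => Finset.sum_congr rfl fun b _ => ?_
    rw [mul_comm a b, mul_comm (f b)]
  have e4 : (∑ a ∈ Finset.Ioc 0 M, f a) * ∑ b ∈ Finset.Ioc 0 M, g b =
      ∑ x ∈ Finset.Ioc 0 N ×ˢ Finset.Ioc 0 N, if x.1 ≤ M ∧ x.2 ≤ M then f x.1 * g x.2 else 0 := by
    rw [Finset.sum_mul_sum, ← Finset.sum_product', ← Finset.sum_filter]
    refine Finset.sum_congr ?_ fun _ _ => rfl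
    ext x
    simp only [Finset.mem_product, Finset.mem_Ioc, Finset.mem_filter]
    omega
  rw [ArithmeticFunction.sum_Ioc_mul_eq_sum_prod_filter, Finset.sum_filter, e1, e2, e3, e4,
    ← Finset.sum_add_distrib, ← Finset.sum_sub_distrib]
  refine Finset.sum_congr rfl fun x _ => ?_
  rcases x with ⟨a, b⟩
  simp only
  -- The two hypotheses say that `M` is the integer square root of `N`: the square of side `M` lies
  -- under the hyperbola, and every point under the hyperbola has a coordinate at most `M`. The rest
  -- is inclusion-exclusion, point by point.
  have hprod : a ≤ M → b ≤ M → a * b ≤ N := fun ha hb => (Nat.mul_le_mul ha hb).trans h1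
  have hone : a * b ≤ N → a ≤ M ∨ b ≤ M := by
    intro hab
    by_contra! hcon
    have : (M + 1) * (M + 1) ≤ a * b := Nat.mul_le_mul hcon.1 hcon.2
    omega
  by_cases ha : a ≤ M <;> by_cases hb : b ≤ M <;> by_cases hab : a * b ≤ N <;>
    first | (simp [ha, hb, hab]; done) | simp_all

theorem floor_sqrt_mul_self_le {x : ℝ} (hx : 0 ≤ x) : ⌊√x⌋₊ * ⌊√x⌋₊ ≤ ⌊x⌋₊ := by
  rw [Nat.le_floor_iff hx]
  have h := Nat.floor_le (Real.sqrt_nonneg x)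
  push_cast
  nlinarith [Real.mul_self_sqrt hx, Nat.cast_nonneg (α := ℝ) ⌊√x⌋₊]

theorem floor_lt_floor_sqrt_add_one {x : ℝ} (hx : 0 ≤ x) :
    ⌊x⌋₊ < (⌊√x⌋₊ + 1) * (⌊√x⌋₊ + 1) := by
  rw [Nat.floor_lt hx]
  have h := Nat.lt_floor_add_one (√x)
  push_cast
  nlinarith [Real.mul_self_sqrt hx, Real.sqrt_nonneg x]

theorem sumDk_four_hyperbola {x : ℝ} (hx : 0 ≤ x) :
    sumDk 4 x = 2 * ∑ a ∈ Finset.Ioc 0 ⌊√x⌋₊, tau a * divSum (x / a) - divSum (√x) ^ 2 := by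
  rw [sumDk_four_eq, sum_Ioc_mul_hyperbola tau tau (floor_sqrt_mul_self_le hx)
    (floor_lt_floor_sqrt_add_one hx)]
  simp only [divSum, Nat.floor_div_natCast]
  ring

theorem divSum_hyperbola {x : ℝ} (hx : 0 ≤ x) :
    divSum x = 2 * ∑ a ∈ Finset.Ioc 0 ⌊√x⌋₊, (⌊x / a⌋₊ : ℝ) - (⌊√x⌋₊ : ℝ) ^ 2 := by
  have hz : ∀ N : ℕ, ∑ b ∈ Finset.Ioc 0 N, (ArithmeticFunction.zeta : ArithmeticFunction ℝ) b = N := by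
    intro N
    rw [Finset.sum_congr rfl fun b hb => zeta_real_apply (Finset.mem_Ioc.1 hb).1.ne']
    simp
  rw [divSum, tau, sum_Ioc_mul_hyperbola _ _ (floor_sqrt_mul_self_le hx)
    (floor_lt_floor_sqrt_add_one hx)]
  simp only [hz, Nat.floor_div_natCast]
  rw [Finset.sum_congr rfl fun b hb => by
    rw [zeta_real_apply (Finset.mem_Ioc.1 hb).1.ne', one_mul]]
  ring

/-! ### An explicit bound in the Dirichlet divisor problem -/

open Filter Topology MeasureTheory

/-- Midpoint rule for `∫ dt/t` over `[1, 1 + z]`, an underestimate by convexity. -/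
theorem two_mul_div_two_add_le_log {z : ℝ} (hz : 0 ≤ z) : 2 * z / (2 + z) ≤ Real.log (1 + z) := by
  have := Real.le_log_one_add_of_nonneg hz
  rwa [add_comm z 2] at this

/-- Trapezoidal rule for the same integral, an overestimate by convexity. -/
theorem log_one_add_le_mul_div {z : ℝ} (hz : 0 ≤ z) :
    Real.log (1 + z) ≤ z * (2 + z) / (2 * (1 + z)) := by
  let f : ℝ → ℝ := fun z => z * (2 + z) / (2 * (1 + z)) - Real.log (1 + z)
  have hd : ∀ t : ℝ, 0 ≤ t → HasDerivAt f (t ^ 2 / (2 * (1 + t) ^ 2)) t := by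
    intro t ht
    have h1 : (1 + t) ≠ 0 := by positivity
    have := (((hasDerivAt_id t).mul ((hasDerivAt_id t).const_add 2)).div
      (((hasDerivAt_id t).const_add 1).const_mul 2) (by simpa using h1)).sub
      (((hasDerivAt_id t).const_add 1).log h1)
    refine this.congr_deriv ?_
    simp only [id, Pi.mul_apply]
    field_simp
    ring
  have hm : MonotoneOn f (Set.Ici 0) := by
    refine monotoneOn_of_deriv_nonneg (convex_Ici 0)
      (fun t ht => (hd t ht).continuousAt.continuousWithinAt) ?_ ?_
    · intro t ht
      rw [interior_Ici] at ht
      exact (hd t (le_of_lt ht)).differentiableAt.differentiableWithinAt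
    · intro t ht
      rw [interior_Ici] at ht
      rw [(hd t (le_of_lt ht)).deriv]
      positivity
  have := hm (Set.mem_Ici.2 le_rfl) (Set.mem_Ici.2 hz) hz
  simp only [f] at this
  norm_num at this
  linarith

/-- By the trapezoidal bound, `H_n - log n - 1/(2n)` increases to its limit `γ`. -/
theorem harmonic_le (N : ℕ) (hN : 0 < N) :
    (harmonic N : ℝ) ≤ Real.eulerMascheroniConstant + Real.log N + 1 / (2 * N) := by
  let s : ℕ → ℝ := fun n => (harmonic (n + 1) : ℝ) - Real.log ((n + 1 : ℕ) : ℝ) - 1 / (2 * ((n + 1 : ℕ) : ℝ))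
  have hmono : Monotone s := by
    refine monotone_nat_of_le_succ fun n => ?_
    have h := log_one_add_le_mul_div (z := 1 / ((n : ℝ) + 1)) (by positivity)
    have e : 1 + 1 / ((n : ℝ) + 1) = ((n : ℝ) + 2) / (n + 1) := by field_simp; ring
    rw [e, Real.log_div (by positivity) (by positivity)] at h
    simp only [s, harmonic_succ (n + 1)]
    push_cast
    have e2 : 1 / ((n : ℝ) + 1) * (2 + 1 / ((n : ℝ) + 1)) / (2 * (((n : ℝ) + 2) / (n + 1))) =
      1 / (2 * ((n : ℝ) + 1)) + 1 / (2 * ((n : ℝ) + 2)) := by field_simp; ring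
    rw [e2] at h
    have e3 : ((n : ℝ) + 1 + 1)⁻¹ = 1 / (2 * ((n : ℝ) + 2)) + 1 / (2 * ((n : ℝ) + 2)) := by
      field_simp; ring
    have e4 : (n : ℝ) + 1 + 1 = n + 2 := by ring
    rw [e3, e4]
    linarith
  have hlim : Tendsto s atTop (𝓝 Real.eulerMascheroniConstant) := by
    have h1 := Real.tendsto_harmonic_sub_log.comp (tendsto_add_atTop_nat 1)
    have h2 : Tendsto (fun n : ℕ => 1 / (2 * ((n + 1 : ℕ) : ℝ))) atTop (𝓝 0) := by
      have := (tendsto_one_div_add_atTop_nhds_zero_nat (𝕜 := ℝ)).const_mul (1 / 2)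
      simp only [mul_zero] at this
      refine this.congr fun n => ?_
      push_cast
      field_simp
    simpa [s, Function.comp_def] using h1.sub h2
  have := hmono.ge_of_tendsto hlim (N - 1)
  simp only [s, Nat.sub_add_cancel hN] at this
  linarith

/-- By the midpoint bound, `H_n - log (n + 1/2)` decreases to its limit `γ`. -/
theorem le_harmonic (N : ℕ) :
    Real.eulerMascheroniConstant + Real.log (N + 1 / 2) ≤ harmonic N := by
  let s : ℕ → ℝ := fun n => (harmonic n : ℝ) - Real.log ((n : ℝ) + 1 / 2)
  have hmono : Antitone s := by
    refine antitone_nat_of_succ_le fun n => ?_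
    have h := two_mul_div_two_add_le_log (z := 1 / ((n : ℝ) + 1 / 2)) (by positivity)
    have e : 1 + 1 / ((n : ℝ) + 1 / 2) = ((n : ℝ) + 1 + 1 / 2) / (n + 1 / 2) := by field_simp; ring
    rw [e, Real.log_div (by positivity) (by positivity)] at h
    have e2 : 2 * (1 / ((n : ℝ) + 1 / 2)) / (2 + 1 / ((n : ℝ) + 1 / 2)) = ((n : ℝ) + 1)⁻¹ := by
      field_simp; ring
    rw [e2] at h
    simp only [s, harmonic_succ n]
    push_cast
    linarith
  have hlim : Tendsto s atTop (𝓝 Real.eulerMascheroniConstant) := by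
    have h1 := Real.tendsto_harmonic_sub_log
    have h2 := (Real.tendsto_log_comp_add_sub_log (1 / 2)).comp (tendsto_natCast_atTop_atTop (R := ℝ))
    simpa [s, Function.comp_def] using h1.sub h2
  have := hmono.le_of_tendsto hlim N
  simp only [s] at this
  linarith

/-- The error term in Dirichlet's divisor problem. -/
noncomputable def divErr (x : ℝ) : ℝ :=
  divSum x - (x * Real.log x + (2 * Real.eulerMascheroniConstant - 1) * x)

theorem sum_inv_Ioc_eq_harmonic (N : ℕ) : ∑ a ∈ Finset.Ioc 0 N, (1 / (a : ℝ)) = harmonic N := by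
  rw [harmonic_eq_sum_Icc]
  push_cast
  refine Finset.sum_congr (by ext; simp [Nat.succ_le_iff]) fun n _ => by simp

/-- Dropping the floors in the hyperbola formula leaves `2 x H_N - N²` with `N = ⌊√x⌋`. Writing `√x
= N + r`, the bounds for `H_N` and `log (√x / N)` reduce the error to `N + 2r - r²`, and `r - r² ≤
1/4`. -/
theorem divErr_le {x : ℝ} (hx : 1 ≤ x) : divErr x ≤ √x + 1 / 4 := by
  have hx0 : 0 ≤ x := by linarith
  set u := √x with hu
  have hxu : x = u ^ 2 := (Real.sq_sqrt hx0).symm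
  have hu1 : 1 ≤ u := Real.one_le_sqrt.2 hx
  have hN1 : 1 ≤ ⌊u⌋₊ := (Nat.one_le_floor_iff _).2 hu1
  have hNle := Nat.floor_le (zero_le_one.trans hu1)
  have hNlt := Nat.lt_floor_add_one u
  have hsum : ∑ a ∈ Finset.Ioc 0 ⌊u⌋₊, (⌊x / a⌋₊ : ℝ) ≤ x * harmonic ⌊u⌋₊ := by
    rw [← sum_inv_Ioc_eq_harmonic, Finset.mul_sum]
    refine Finset.sum_le_sum fun a _ => ?_
    refine (Nat.floor_le (by positivity)).trans (le_of_eq (by ring))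
  have hD := divSum_hyperbola hx0
  rw [← hu] at hD
  have hH := harmonic_le ⌊u⌋₊ hN1
  unfold divErr
  rw [hD]
  clear_value u
  subst hxu
  set H : ℝ := (harmonic ⌊u⌋₊ : ℝ)
  have hNr : (1 : ℝ) ≤ (⌊u⌋₊ : ℝ) := by exact_mod_cast hN1
  generalize (⌊u⌋₊ : ℝ) = N at *
  have hlog : 2 * (u - N) / (u + N) ≤ Real.log u - Real.log N := by
    have := two_mul_div_two_add_le_log (z := (u - N) / N) (div_nonneg (by linarith) (by linarith))
    have e : 1 + (u - N) / N = u / N := by field_simp; ring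
    rw [e, Real.log_div (by linarith) (by linarith)] at this
    convert this using 1
    have : u + N ≠ 0 := by linarith
    field_simp
    ring
  have hlx : Real.log (u ^ 2) = 2 * Real.log u := by rw [Real.log_pow]; norm_num
  have h1 : u ^ 2 * H ≤ u ^ 2 * (Real.eulerMascheroniConstant + Real.log N + 1 / (2 * N)) :=
    mul_le_mul_of_nonneg_left hH hx0
  have h2 : u ^ 2 * (2 * (u - N) / (u + N)) ≤ u ^ 2 * (Real.log u - Real.log N) :=
    mul_le_mul_of_nonneg_left hlog hx0
  have h3 : u ^ 2 - N ^ 2 + u ^ 2 / N - 2 * (u ^ 2 * (2 * (u - N) / (u + N))) ≤ u + 1 / 4 := by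
    clear hlog h1 h2 hlx hsum hD hH hx hx0 hu
    obtain ⟨r, rfl⟩ : ∃ r, u = N + r := ⟨u - N, by ring⟩
    have hr : 0 ≤ r := by linarith
    have e1 : (N + r) ^ 2 / N ≤ N + 2 * r + r ^ 2 := by
      rw [div_le_iff₀ (by linarith)]
      nlinarith
    have e2 : 4 * (N + r) ^ 2 * r / (2 * N + r) ≥ 2 * N * r + 3 * r ^ 2 := by
      rw [ge_iff_le, le_div_iff₀ (by linarith)]
      nlinarith [pow_nonneg hr 3]
    have e3 : 2 * ((N + r) ^ 2 * (2 * (N + r - N) / (N + r + N))) =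
      4 * (N + r) ^ 2 * r / (2 * N + r) := by
      have : 2 * N + r ≠ 0 := by linarith
      rw [show N + r + N = 2 * N + r by ring]
      field_simp
      ring
    rw [e3]
    nlinarith [sq_nonneg (r - 1 / 2)]
  rw [hlx]
  have h4 : u ^ 2 * (1 / (2 * N)) * 2 = u ^ 2 / N := by field_simp
  linarith

/-- Each floor now costs at most 1, hence `2N` in all. Comparing `√x` with `N + 1/2`, the shift in
`le_harmonic`, recovers the constant `1/4`. -/
theorem le_divErr {x : ℝ} (hx : 1 ≤ x) : -(√x + 1 / 4) ≤ divErr x := by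
  have hx0 : 0 ≤ x := by linarith
  set u := √x with hu
  have hxu : x = u ^ 2 := (Real.sq_sqrt hx0).symm
  have hu1 : 1 ≤ u := Real.one_le_sqrt.2 hx
  have hN1 : 1 ≤ ⌊u⌋₊ := (Nat.one_le_floor_iff _).2 hu1
  have hNle := Nat.floor_le (zero_le_one.trans hu1)
  have hNlt := Nat.lt_floor_add_one u
  have hsum : x * harmonic ⌊u⌋₊ - ⌊u⌋₊ ≤ ∑ a ∈ Finset.Ioc 0 ⌊u⌋₊, (⌊x / a⌋₊ : ℝ) := by
    have : (⌊u⌋₊ : ℝ) = ∑ a ∈ Finset.Ioc 0 ⌊u⌋₊, (1 : ℝ) := by simp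
    rw [← sum_inv_Ioc_eq_harmonic, Finset.mul_sum, this, ← Finset.sum_sub_distrib]
    refine Finset.sum_le_sum fun a _ => ?_
    have := Nat.lt_floor_add_one (x / a)
    rw [mul_one_div]
    linarith
  have hD := divSum_hyperbola hx0
  rw [← hu] at hD
  have hH := le_harmonic ⌊u⌋₊
  unfold divErr
  rw [hD]
  clear_value u
  subst hxu
  set H : ℝ := (harmonic ⌊u⌋₊ : ℝ)
  have hNr : (1 : ℝ) ≤ (⌊u⌋₊ : ℝ) := by exact_mod_cast hN1
  generalize (⌊u⌋₊ : ℝ) = N at *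
  have hlx : Real.log (u ^ 2) = 2 * Real.log u := by rw [Real.log_pow]; norm_num
  have h1 : u ^ 2 * (Real.eulerMascheroniConstant + Real.log (N + 1 / 2)) ≤ u ^ 2 * H :=
    mul_le_mul_of_nonneg_left hH hx0
  have hlog : N ^ 2 + 2 * N - u ^ 2 - u - 1 / 4 ≤
      2 * u ^ 2 * (Real.log (N + 1 / 2) - Real.log u) := by
    rw [← Real.log_div (by linarith) (by linarith)]
    -- If `u ≤ N + 1/2` and `r = N + 1/2 - u`, the claim reduces to `(2r - 1)(r + 1) ≤ 0`, that is
    -- `r ≤ 1/2`, which is `N ≤ u`.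
    rcases le_total u (N + 1 / 2) with h | h
    · have := two_mul_div_two_add_le_log (z := (N + 1 / 2 - u) / u)
        (div_nonneg (by linarith) (by linarith))
      have e : 1 + (N + 1 / 2 - u) / u = (N + 1 / 2) / u := by field_simp; ring
      rw [e] at this
      obtain ⟨r, hr⟩ : ∃ r, N = u + r - 1 / 2 := ⟨N + 1 / 2 - u, by ring⟩
      subst hr
      refine le_trans ?_ (mul_le_mul_of_nonneg_left this (by linarith))
      have e2 : 2 * u ^ 2 * (2 * ((u + r - 1 / 2 + 1 / 2 - u) / u) /
          (2 + (u + r - 1 / 2 + 1 / 2 - u) / u)) = 4 * u ^ 2 * r / (2 * u + r) := by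
        have : 2 * u + r ≠ 0 := by linarith
        rw [show u + r - 1 / 2 + 1 / 2 - u = r by ring, show 2 + r / u = (2 * u + r) / u by field_simp]
        field_simp
        ring
      have e3 : r * (2 * u - r) ≤ 4 * u ^ 2 * r / (2 * u + r) := by
        rw [le_div_iff₀ (by linarith)]
        have hr0 : 0 ≤ r := by linarith
        nlinarith [pow_nonneg hr0 3]
      rw [e2]
      refine le_trans ?_ e3
      nlinarith
    · have := Real.one_sub_inv_le_log_of_pos (x := (N + 1 / 2) / u)
        (div_pos (by linarith) (by linarith))
      refine le_trans ?_ (mul_le_mul_of_nonneg_left this (by linarith))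
      obtain ⟨r, hr⟩ : ∃ r, u = N + 1 / 2 + r := ⟨u - (N + 1 / 2), by ring⟩
      have hr0 : 0 ≤ r := by linarith
      have e2 : 2 * u ^ 2 * (1 - ((N + 1 / 2) / u)⁻¹) = -(2 * u ^ 2 * r / (N + 1 / 2)) := by
        rw [inv_div, hr]
        have : N + 1 / 2 ≠ 0 := by linarith
        field_simp
        ring
      rw [e2, le_neg, div_le_iff₀ (by linarith), hr]
      nlinarith [pow_nonneg hr0 3, mul_nonneg hr0 (sub_nonneg.2 hNr)]
  rw [hlx]
  linarith

theorem abs_divErr_le {x : ℝ} (hx : 1 ≤ x) : |divErr x| ≤ √x + 1 / 4 :=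
  abs_le.2 ⟨le_divErr hx, divErr_le hx⟩

/-! ### Euler-Maclaurin summation for the Stieltjes constants -/

theorem abs_le_mul_pow_of_abs_deriv_le {g g' : ℝ → ℝ} {c : ℝ} {n : ℕ} (h0 : g 0 = 0)
    (hg : ∀ t ∈ Set.Icc (0 : ℝ) 1, HasDerivAt g (g' t) t)
    (hb : ∀ t ∈ Set.Icc (0 : ℝ) 1, |g' t| ≤ c * t ^ n) :
    ∀ t ∈ Set.Icc (0 : ℝ) 1, |g t| ≤ c / (n + 1) * t ^ (n + 1) := by
  have hB : ∀ t : ℝ, HasDerivAt (fun t : ℝ => c / (n + 1) * t ^ (n + 1)) (c * t ^ n) t := by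
    intro t
    refine ((hasDerivAt_pow (n + 1) t).const_mul (c / (n + 1))).congr_deriv ?_
    push_cast
    have : (n : ℝ) + 1 ≠ 0 := by positivity
    field_simp
  exact image_norm_le_of_norm_deriv_right_le_deriv_boundary'
    (fun t ht => (hg t ht).continuousAt.continuousWithinAt)
    (fun t ht => (hg t (Set.Ico_subset_Icc_self ht)).hasDerivWithinAt)
    (by simp [h0]) (fun t _ => (hB t).continuousAt.continuousWithinAt)
    (fun t _ => (hB t).hasDerivWithinAt) (fun t ht => hb t (Set.Ico_subset_Icc_self ht))

/-- Euler-Maclaurin on an interval of length one, with the fourth derivative in the remainder. -/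
theorem abs_euler_maclaurin_le {F f f₁ f₂ f₃ f₄ : ℝ → ℝ} {a K : ℝ}
    (hF : ∀ t ∈ Set.Icc a (a + 1), HasDerivAt F (f t) t)
    (hf : ∀ t ∈ Set.Icc a (a + 1), HasDerivAt f (f₁ t) t)
    (hf₁ : ∀ t ∈ Set.Icc a (a + 1), HasDerivAt f₁ (f₂ t) t)
    (hf₂ : ∀ t ∈ Set.Icc a (a + 1), HasDerivAt f₂ (f₃ t) t)
    (hf₃ : ∀ t ∈ Set.Icc a (a + 1), HasDerivAt f₃ (f₄ t) t)
    (hK : ∀ t ∈ Set.Icc a (a + 1), |f₄ t| ≤ K) :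
    |F (a + 1) - F a - (f a + f (a + 1)) / 2 + (f₁ (a + 1) - f₁ a) / 12| ≤ K / 720 := by
  have hs : ∀ t ∈ Set.Icc (0 : ℝ) 1, a + t ∈ Set.Icc a (a + 1) := fun t ht =>
    ⟨by linarith [ht.1], by linarith [ht.2]⟩
  -- The remainder on `[a, a + t]` vanishes at `t = 0` with its first two derivatives, and its third
  -- derivative is `t² f₄(a + t) / 12`. Three integrations turn `K t² / 12` into `K t⁵ / (12 · 3 · 4
  -- · 5)`.
  have h3 : ∀ t ∈ Set.Icc (0 : ℝ) 1,
      |(f₁ (a + t) - f₁ a) / 6 - t * f₂ (a + t) / 6 + t ^ 2 * f₃ (a + t) / 12| ≤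
        K / 12 / ((2 : ℕ) + 1) * t ^ (2 + 1) := by
    refine abs_le_mul_pow_of_abs_deriv_le (g' := fun t => t ^ 2 * f₄ (a + t) / 12) (by simp) ?_ ?_
    · intro t ht
      have d1 := (hf₁ _ (hs t ht)).comp_const_add a t
      have d2 := (hf₂ _ (hs t ht)).comp_const_add a t
      have d3 := (hf₃ _ (hs t ht)).comp_const_add a t
      refine ((((d1.sub_const (f₁ a)).div_const 6).sub
        (((hasDerivAt_id t).mul d2).div_const 6)).add
        (((hasDerivAt_pow 2 t).mul d3).div_const 12)).congr_deriv ?_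
      simp only [id]
      push_cast
      ring
    · intro t ht
      rw [abs_div, abs_mul, abs_of_nonneg (sq_nonneg t), abs_of_pos (by norm_num : (0 : ℝ) < 12)]
      have := mul_le_mul_of_nonneg_left (hK _ (hs t ht)) (sq_nonneg t)
      linarith
  have h2 : ∀ t ∈ Set.Icc (0 : ℝ) 1,
      |(f (a + t) - f a) / 2 - t * f₁ (a + t) / 3 - t * f₁ a / 6 + t ^ 2 * f₂ (a + t) / 12| ≤
        K / 12 / ((2 : ℕ) + 1) / ((2 + 1 : ℕ) + 1) * t ^ (2 + 1 + 1) := by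
    refine abs_le_mul_pow_of_abs_deriv_le (by simp) ?_ h3
    intro t ht
    have d0 := (hf _ (hs t ht)).comp_const_add a t
    have d1 := (hf₁ _ (hs t ht)).comp_const_add a t
    have d2 := (hf₂ _ (hs t ht)).comp_const_add a t
    refine (((((d0.sub_const (f a)).div_const 2).sub
      (((hasDerivAt_id t).mul d1).div_const 3)).sub
      (((hasDerivAt_id t).mul_const (f₁ a)).div_const 6)).add
      (((hasDerivAt_pow 2 t).mul d2).div_const 12)).congr_deriv ?_
    simp only [id]
    push_cast
    ring
  have h1 := abs_le_mul_pow_of_abs_deriv_le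
    (g := fun t => F (a + t) - F a - t * (f a + f (a + t)) / 2 + t ^ 2 * (f₁ (a + t) - f₁ a) / 12)
    (by simp) (fun t ht => by
      have dF := (hF _ (hs t ht)).comp_const_add a t
      have d0 := (hf _ (hs t ht)).comp_const_add a t
      have d1 := (hf₁ _ (hs t ht)).comp_const_add a t
      refine (((dF.sub_const (F a)).sub
        (((hasDerivAt_id t).mul (d0.const_add (f a))).div_const 2)).add
        (((hasDerivAt_pow 2 t).mul (d1.sub_const (f₁ a))).div_const 12)).congr_deriv ?_
      simp only [id]
      push_cast
      ring) h2 1 (by simp)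
  simp only [one_mul, one_pow, mul_one] at h1
  refine h1.trans (le_of_eq ?_)
  push_cast
  ring

/-- The intervals `[s n - b n, s n + b n]` are nested and shrink to a point. -/
theorem exists_tendsto_of_abs_sub_le {s b : ℕ → ℝ} (h : ∀ n, |s (n + 1) - s n| ≤ b n - b (n + 1))
    (hb : Tendsto b atTop (𝓝 0)) : ∃ l, Tendsto s atTop (𝓝 l) ∧ ∀ n, |l - s n| ≤ b n := by
  have hmono : Monotone fun n => s n - b n := monotone_nat_of_le_succ fun n => by
    linarith [(abs_le.1 (h n)).1]
  have hanti : Antitone fun n => s n + b n := antitone_nat_of_succ_le fun n => by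
    linarith [(abs_le.1 (h n)).2]
  have hbm : Antitone b := antitone_nat_of_succ_le fun n => by
    linarith [abs_nonneg (s (n + 1) - s n), h n]
  have hb0 : ∀ n, 0 ≤ b n := fun n => hbm.le_of_tendsto hb n
  have hlim := tendsto_atTop_ciSup hmono
    ⟨s 0 + b 0, by rintro _ ⟨n, rfl⟩; have := hanti (Nat.zero_le n); simp only at this ⊢; linarith [hb0 n]⟩
  set l := ⨆ n, (s n - b n)
  have hs : Tendsto s atTop (𝓝 l) := by simpa using hlim.add hb
  refine ⟨l, hs, fun n => abs_le.2 ⟨?_, ?_⟩⟩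
  · have := hmono.ge_of_tendsto hlim n
    linarith
  · have := hanti.le_of_tendsto (by simpa using hs.add hb : Tendsto (fun n => s n + b n) atTop (𝓝 l)) n
    linarith

/-- The sequence whose limit is the Stieltjes constant. -/
noncomputable def stieltjesSeq (k N : ℕ) : ℝ :=
  (∑ m ∈ Finset.Icc 1 N, Real.log m ^ k / m) - Real.log N ^ (k + 1) / (k + 1)

theorem stieltjes_euler_maclaurin {k : ℕ} {f₁ f₂ f₃ f₄ : ℝ → ℝ} {N : ℕ} {K : ℝ} (hN : 2 ≤ N)
    (hf : ∀ t : ℝ, 1 ≤ t → HasDerivAt (fun t => Real.log t ^ k / t) (f₁ t) t)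
    (hf₁ : ∀ t : ℝ, 1 ≤ t → HasDerivAt f₁ (f₂ t) t)
    (hf₂ : ∀ t : ℝ, 1 ≤ t → HasDerivAt f₂ (f₃ t) t)
    (hf₃ : ∀ t : ℝ, 1 ≤ t → HasDerivAt f₃ (f₄ t) t)
    (hK : ∀ t : ℝ, N ≤ t → |f₄ t| ≤ K / t ^ 4)
    (hl : Tendsto (fun t : ℝ => Real.log t ^ k / t) atTop (𝓝 0)) (hl₁ : Tendsto f₁ atTop (𝓝 0)) :
    Tendsto (stieltjesSeq k) atTop (𝓝 (stieltjesConstant k)) ∧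
      |stieltjesConstant k - (stieltjesSeq k N - Real.log N ^ k / N / 2 - f₁ N / 12)| ≤
        K / (2160 * ((N : ℝ) - 1) ^ 3) := by
  have hK0 : 0 ≤ K := by
    have h := (abs_nonneg _).trans (hK N le_rfl)
    have hN' : (0 : ℝ) < (N : ℝ) ^ 4 := by positivity
    rwa [le_div_iff₀ hN', zero_mul] at h
  let s : ℕ → ℝ := fun n => stieltjesSeq k (n + N) - Real.log (n + N : ℕ) ^ k / (n + N : ℕ) / 2
    - f₁ (n + N : ℕ) / 12
  let b : ℕ → ℝ := fun n => K / (2160 * (((n + N : ℕ) : ℝ) - 1) ^ 3)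
  have hstep : ∀ n, |s (n + 1) - s n| ≤ b n - b (n + 1) := by
    intro n
    set a : ℝ := ((n + N : ℕ) : ℝ) with ha
    have ha2 : 2 ≤ a := by rw [ha]; exact_mod_cast hN.trans (Nat.le_add_left N n)
    have haN : (N : ℝ) ≤ a := by rw [ha]; exact_mod_cast Nat.le_add_left N n
    have hcast : ((n + 1 + N : ℕ) : ℝ) = a + 1 := by rw [ha]; push_cast; ring
    have em := abs_euler_maclaurin_le (a := a) (K := K / a ^ 4)
      (F := fun t => Real.log t ^ (k + 1) / (k + 1)) (f := fun t => Real.log t ^ k / t)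
      (f₁ := f₁) (f₂ := f₂) (f₃ := f₃) (f₄ := f₄)
      (fun t ht => by
        have ht0 : t ≠ 0 := by linarith [ht.1]
        refine (((Real.hasDerivAt_log ht0).pow (k + 1)).div_const _).congr_deriv ?_
        push_cast
        have : (k : ℝ) + 1 ≠ 0 := by positivity
        field_simp)
      (fun t ht => hf t (by linarith [ht.1])) (fun t ht => hf₁ t (by linarith [ht.1]))
      (fun t ht => hf₂ t (by linarith [ht.1])) (fun t ht => hf₃ t (by linarith [ht.1]))
      (fun t ht => (hK t (haN.trans ht.1)).trans
        (div_le_div_of_nonneg_left hK0 (by positivity) (pow_le_pow_left₀ (by linarith) ht.1 4)))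
    have hs : s (n + 1) - s n = -(Real.log (a + 1) ^ (k + 1) / (k + 1) - Real.log a ^ (k + 1) / (k + 1)
        - (Real.log a ^ k / a + Real.log (a + 1) ^ k / (a + 1)) / 2 + (f₁ (a + 1) - f₁ a) / 12) := by
      simp only [s, stieltjesSeq]
      rw [show n + 1 + N = (n + N) + 1 by ring, Finset.sum_Icc_succ_top (by omega)]
      push_cast at ha ⊢
      rw [← ha]
      ring
    rw [hs, abs_neg]
    refine em.trans ?_
    simp only [b, hcast]
    rw [← ha, add_sub_cancel_right]
    have h1 : 0 < a - 1 := by linarith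
    rw [div_div, div_sub_div _ _ (by positivity) (by positivity), div_le_div_iff₀ (by positivity) (by positivity)]
    -- This is `1/a⁴ ≤ (1/(a-1)³ - 1/a³)/3`, which makes the error `K/(720 a⁴)` telescope; hence
    -- `2160 = 3 · 720`.
    have key : (a - 1) ^ 3 * 3 ≤ a * (a ^ 3 - (a - 1) ^ 3) := by nlinarith
    have h2 : 0 ≤ K * a ^ 3 * (a - 1) ^ 3 := by positivity
    have h3 : 0 ≤ K * a ^ 3 * 720 * 2160 := by positivity
    nlinarith [mul_le_mul_of_nonneg_left key h3]
  have hcastN : Tendsto (fun n : ℕ => ((n + N : ℕ) : ℝ)) atTop atTop :=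
    tendsto_natCast_atTop_atTop.comp (tendsto_add_atTop_nat N)
  have hb : Tendsto b atTop (𝓝 0) := by
    have h1 : Tendsto (fun n : ℕ => ((n + N : ℕ) : ℝ) - 1) atTop atTop :=
      tendsto_atTop_add_const_right _ _ hcastN
    have h2 := ((tendsto_pow_atTop (three_ne_zero)).comp h1).const_mul_atTop
      (by norm_num : (0 : ℝ) < 2160)
    exact h2.const_div_atTop K
  obtain ⟨l, hsl, hbl⟩ := exists_tendsto_of_abs_sub_le hstep hb
  have hseq : Tendsto (stieltjesSeq k) atTop (𝓝 l) := by
    rw [← tendsto_add_atTop_iff_nat N]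
    have h1 := (hl.comp hcastN).div_const 2
    have h2 := (hl₁.comp hcastN).div_const 12
    have := (hsl.add h1).add h2
    simp only [zero_div, add_zero] at this
    refine this.congr fun n => ?_
    simp only [s, Function.comp_apply]
    ring
  have hst : stieltjesConstant k = l := hseq.limUnder_eq
  rw [hst]
  refine ⟨hseq, ?_⟩
  simpa [s, b] using hbl 0

theorem log_nonneg_and_le_two_mul_sqrt {t : ℝ} (ht : 1 ≤ t) :
    0 ≤ Real.log t ∧ Real.log t ≤ 2 * √t := by
  refine ⟨Real.log_nonneg ht, ?_⟩
  have h := Real.log_le_sub_one_of_pos (Real.sqrt_pos.2 (by linarith : 0 < t))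
  rw [Real.log_sqrt (by linarith)] at h
  linarith

theorem tendsto_log_pow_div_pow (j m : ℕ) (hm : 0 < m) :
    Tendsto (fun t : ℝ => Real.log t ^ j / t ^ m) atTop (𝓝 0) := by
  have := (isLittleO_log_rpow_rpow_atTop (j : ℝ) (s := (m : ℝ)) (by exact_mod_cast hm)).tendsto_div_nhds_zero
  simpa using this

/-- In this and the next two bounds `K = 7` majorizes `t⁴ |f₄(t)|` for `t ≥ 10`. At `N = 10` the
error `7/(2160 · 9³)` is below `5 · 10⁻⁶`, enough for three decimals of `C₂`, `C₃`, `C₄`. -/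
theorem stieltjes_zero_bound {N : ℕ} (hN : 10 ≤ N) :
    Tendsto (stieltjesSeq 0) atTop (𝓝 (stieltjesConstant 0)) ∧
    |stieltjesConstant 0 - (stieltjesSeq 0 N - 1 / (2 * N) + 1 / (12 * (N : ℝ) ^ 2))| ≤
      7 / (2160 * ((N : ℝ) - 1) ^ 3) := by
  have hN' : (10 : ℝ) ≤ N := by exact_mod_cast hN
  have h := stieltjes_euler_maclaurin (k := 0) (N := N) (K := 7)
    (f₁ := fun t => -1 / t ^ 2) (f₂ := fun t => 2 / t ^ 3) (f₃ := fun t => -6 / t ^ 4)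
    (f₄ := fun t => 24 / t ^ 5) (by omega) ?_ ?_ ?_ ?_ ?_ ?_ ?_
  · refine ⟨h.1, ?_⟩
    convert h.2 using 3
    have : (N : ℝ) ≠ 0 := by linarith
    field_simp
    ring
  · intro t ht
    have h0 : t ≠ 0 := by linarith
    simp only [pow_zero]
    refine ((hasDerivAt_const t 1).div (hasDerivAt_id t) h0).congr_deriv ?_
    simp
  · intro t ht
    have h0 : t ≠ 0 := by linarith
    refine ((hasDerivAt_const t (-1)).div (hasDerivAt_pow 2 t) (by positivity)).congr_deriv ?_
    push_cast
    field_simp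
    ring
  · intro t ht
    have h0 : t ≠ 0 := by linarith
    refine ((hasDerivAt_const t 2).div (hasDerivAt_pow 3 t) (by positivity)).congr_deriv ?_
    push_cast
    field_simp
    ring
  · intro t ht
    have h0 : t ≠ 0 := by linarith
    refine ((hasDerivAt_const t (-6)).div (hasDerivAt_pow 4 t) (by positivity)).congr_deriv ?_
    push_cast
    field_simp
    ring
  · intro t ht
    have h0 : 0 < t := by linarith
    rw [abs_of_nonneg (by positivity), div_le_div_iff₀ (by positivity) (by positivity)]
    have : 0 < t ^ 4 := by positivity
    nlinarith
  · simpa using tendsto_log_pow_div_pow 0 1 one_pos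
  · have := (tendsto_log_pow_div_pow 0 2 two_pos).const_mul (-1)
    simpa [neg_div] using this

theorem stieltjes_one_bound {N : ℕ} (hN : 10 ≤ N) :
    Tendsto (stieltjesSeq 1) atTop (𝓝 (stieltjesConstant 1)) ∧
    |stieltjesConstant 1 - (stieltjesSeq 1 N - Real.log N / (2 * N)
        - (1 - Real.log N) / (12 * (N : ℝ) ^ 2))| ≤
      7 / (2160 * ((N : ℝ) - 1) ^ 3) := by
  have hN' : (10 : ℝ) ≤ N := by exact_mod_cast hN
  have h := stieltjes_euler_maclaurin (k := 1) (N := N) (K := 7)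
    (f₁ := fun t => (1 - Real.log t) / t ^ 2) (f₂ := fun t => (2 * Real.log t - 3) / t ^ 3)
    (f₃ := fun t => (11 - 6 * Real.log t) / t ^ 4)
    (f₄ := fun t => (24 * Real.log t - 50) / t ^ 5) (by omega) ?_ ?_ ?_ ?_ ?_ ?_ ?_
  · refine ⟨h.1, ?_⟩
    convert h.2 using 3
    have : (N : ℝ) ≠ 0 := by linarith
    field_simp
  · intro t ht
    have h0 : t ≠ 0 := by linarith
    simp only [pow_one]
    refine ((Real.hasDerivAt_log h0).div (hasDerivAt_id t) h0).congr_deriv ?_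
    simp only [id]
    field_simp
  · intro t ht
    have h0 : t ≠ 0 := by linarith
    refine (((Real.hasDerivAt_log h0).const_sub 1).div (hasDerivAt_pow 2 t)
      (by positivity)).congr_deriv ?_
    push_cast
    field_simp
    ring
  · intro t ht
    have h0 : t ≠ 0 := by linarith
    refine ((((Real.hasDerivAt_log h0).const_mul 2).sub_const 3).div (hasDerivAt_pow 3 t)
      (by positivity)).congr_deriv ?_
    push_cast
    field_simp
    ring
  · intro t ht
    have h0 : t ≠ 0 := by linarith
    refine ((((Real.hasDerivAt_log h0).const_mul 6).const_sub 11).div (hasDerivAt_pow 4 t)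
      (by positivity)).congr_deriv ?_
    push_cast
    field_simp
    ring
  · intro t ht
    have h0 : 0 < t := by linarith
    rw [abs_div, abs_of_pos (by positivity : 0 < t ^ 5), div_le_div_iff₀ (by positivity) (by positivity)]
    have h4 : 0 < t ^ 4 := by positivity
    have hl0 := Real.log_nonneg (by linarith : 1 ≤ t)
    -- Tangent line of `log` at 10.
    have hl : Real.log t ≤ 2.3026 + (t / 10 - 1) := by
      have := Real.log_le_sub_one_of_pos (x := t / 10) (by positivity)
      rw [Real.log_div h0.ne' (by norm_num), Real.log_ten_eq] at this
      linarith [Real.log_two_lt_d9, Real.log_five_lt_d9]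
    have : |24 * Real.log t - 50| ≤ 7 * t := abs_le.2 ⟨by linarith, by linarith⟩
    nlinarith
  · simpa using tendsto_log_pow_div_pow 1 1 one_pos
  · have := (tendsto_log_pow_div_pow 0 2 two_pos).sub (tendsto_log_pow_div_pow 1 2 two_pos)
    simpa [sub_div] using this

theorem stieltjes_two_bound {N : ℕ} (hN : 10 ≤ N) :
    Tendsto (stieltjesSeq 2) atTop (𝓝 (stieltjesConstant 2)) ∧
    |stieltjesConstant 2 - (stieltjesSeq 2 N - Real.log N ^ 2 / (2 * N)
        - (2 * Real.log N - Real.log N ^ 2) / (12 * (N : ℝ) ^ 2))| ≤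
      7 / (2160 * ((N : ℝ) - 1) ^ 3) := by
  have hN' : (10 : ℝ) ≤ N := by exact_mod_cast hN
  have h := stieltjes_euler_maclaurin (k := 2) (N := N) (K := 7)
    (f₁ := fun t => (2 * Real.log t - Real.log t ^ 2) / t ^ 2)
    (f₂ := fun t => (2 * Real.log t ^ 2 - 6 * Real.log t + 2) / t ^ 3)
    (f₃ := fun t => (22 * Real.log t - 6 * Real.log t ^ 2 - 12) / t ^ 4)
    (f₄ := fun t => (24 * Real.log t ^ 2 - 100 * Real.log t + 70) / t ^ 5) (by omega) ?_ ?_ ?_ ?_ ?_ ?_ ?_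
  · refine ⟨h.1, ?_⟩
    convert h.2 using 3
    have : (N : ℝ) ≠ 0 := by linarith
    field_simp
  · intro t ht
    have h0 : t ≠ 0 := by linarith
    refine (((Real.hasDerivAt_log h0).pow 2).div (hasDerivAt_id t) h0).congr_deriv ?_
    simp only [id]
    push_cast
    field_simp
    simp
    ring
  · intro t ht
    have h0 : t ≠ 0 := by linarith
    refine ((((Real.hasDerivAt_log h0).const_mul 2).sub ((Real.hasDerivAt_log h0).pow 2)).div
      (hasDerivAt_pow 2 t) (by positivity)).congr_deriv ?_
    push_cast
    simp only [Pi.sub_apply, Pi.pow_apply]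
    field_simp
    ring
  · intro t ht
    have h0 : t ≠ 0 := by linarith
    refine ((((((Real.hasDerivAt_log h0).pow 2).const_mul 2).sub
      ((Real.hasDerivAt_log h0).const_mul 6)).add_const 2).div (hasDerivAt_pow 3 t)
      (by positivity)).congr_deriv ?_
    push_cast
    simp only [Pi.sub_apply, Pi.pow_apply]
    field_simp
    ring
  · intro t ht
    have h0 : t ≠ 0 := by linarith
    refine (((((Real.hasDerivAt_log h0).const_mul 22).sub
      (((Real.hasDerivAt_log h0).pow 2).const_mul 6)).sub_const 12).div (hasDerivAt_pow 4 t)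
      (by positivity)).congr_deriv ?_
    push_cast
    simp only [Pi.sub_apply, Pi.pow_apply]
    field_simp
    ring
  · intro t ht
    have h0 : 0 < t := by linarith
    rw [abs_div, abs_of_pos (by positivity : 0 < t ^ 5), div_le_div_iff₀ (by positivity) (by positivity)]
    have h4 : 0 < t ^ 4 := by positivity
    have hl0 : 2.3 ≤ Real.log t := by
      have : Real.log 10 ≤ Real.log t := Real.log_le_log (by norm_num) (by linarith)
      rw [Real.log_ten_eq] at this
      linarith [Real.log_two_gt_d9, Real.log_five_gt_d9]
    -- Tangent line of `log` at 4, applied to `√t`; here `0.773` rounds up `4 log 2 - 2`.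
    have hl : Real.log t ≤ 0.773 + √t / 2 := by
      have hs := Real.sqrt_pos.2 h0
      have := Real.log_le_sub_one_of_pos (x := √t / 4) (by positivity)
      rw [Real.log_div hs.ne' (by norm_num), Real.log_four_eq, Real.log_sqrt h0.le] at this
      linarith [Real.log_two_lt_d9]
    have hsq := Real.sq_sqrt h0.le
    have hs0 := Real.sqrt_nonneg t
    have : |24 * Real.log t ^ 2 - 100 * Real.log t + 70| ≤ 7 * t := by
      refine abs_le.2 ⟨by nlinarith [sq_nonneg (24 * Real.log t - 50)], ?_⟩
      have h2 : Real.log t ^ 2 ≤ (0.773 + √t / 2) ^ 2 := pow_le_pow_left₀ (by linarith) hl 2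
      nlinarith [sq_nonneg (√t - 9.3)]
    nlinarith
  · simpa using tendsto_log_pow_div_pow 2 1 one_pos
  · have := ((tendsto_log_pow_div_pow 1 2 two_pos).const_mul 2).sub (tendsto_log_pow_div_pow 2 2 two_pos)
    simpa [sub_div, mul_div_assoc] using this

theorem stieltjesConstant_zero : stieltjesConstant 0 = Real.eulerMascheroniConstant := by
  refine tendsto_nhds_unique (stieltjes_zero_bound le_rfl).1
    (Real.tendsto_harmonic_sub_log.congr fun n => ?_)
  simp [stieltjesSeq, harmonic_eq_sum_Icc]

/-! ### Partial summation against the divisor error term -/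

theorem sum_Icc_tau_eq_divSum (t : ℝ) : ∑ k ∈ Finset.Icc 0 ⌊t⌋₊, tau k = divSum t := by
  rw [Finset.Icc_eq_cons_Ioc (Nat.zero_le _), Finset.sum_cons, divSum]
  simp

/-- The main term in Dirichlet's divisor problem. -/
noncomputable def divMain (x : ℝ) : ℝ :=
  x * Real.log x + (2 * Real.eulerMascheroniConstant - 1) * x

theorem divSum_eq (x : ℝ) : divSum x = divMain x + divErr x := by
  unfold divErr divMain
  ring

theorem continuousOn_divMain {a b : ℝ} (ha : 0 < a) : ContinuousOn divMain (Set.Icc a b) := by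
  unfold divMain
  have : ContinuousOn Real.log (Set.Icc a b) :=
    Real.continuousOn_log.mono fun t ht => (ha.trans_le ht.1).ne'
  fun_prop

theorem intervalIntegrable_mul_divErr {g : ℝ → ℝ} {a b : ℝ} (ha : 0 < a) (hab : a ≤ b)
    (hg : ContinuousOn g (Set.Icc a b)) :
    IntervalIntegrable (fun t => g t * divErr t) volume a b := by
  rw [intervalIntegrable_iff_integrableOn_Icc_of_le hab]
  have h1 : IntegrableOn (fun t => g t * divSum t) (Set.Icc a b) := by
    have := integrableOn_mul_sum_Icc (fun n : ℕ => tau n) (m := 0) (b := b) ha.le hg.integrableOn_Icc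
    simpa only [sum_Icc_tau_eq_divSum] using this
  have h2 : IntegrableOn (fun t => g t * divMain t) (Set.Icc a b) :=
    (hg.mul (continuousOn_divMain ha)).integrableOn_Icc
  refine (h1.sub h2).congr_fun (fun t _ => ?_) measurableSet_Icc
  simp only [Pi.sub_apply, divSum_eq]
  ring

/-- Abel summation with `D` split into main term and `Δ`. The main integral is elementary and enters
through an antiderivative `P`, so that only an integral of `Δ` remains. -/
theorem sum_tau_mul_eq {f f' P : ℝ → ℝ} {b : ℝ} (hb : 1 ≤ b)
    (hf : ∀ t ∈ Set.Icc 1 b, HasDerivAt f (f' t) t) (hf' : ContinuousOn f' (Set.Icc 1 b))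
    (hP : ∀ t ∈ Set.Icc 1 b, HasDerivAt P (f' t * divMain t) t) :
    ∑ a ∈ Finset.Ioc 0 ⌊b⌋₊, tau a * f a =
      f b * divMain b + f b * divErr b - (P b - P 1) - ∫ t in (1 : ℝ)..b, f' t * divErr t := by
  have hd : Set.EqOn (deriv f) f' (Set.Icc 1 b) := fun t ht => (hf t ht).deriv
  have h := sum_mul_eq_sub_integral_mul₀ (fun n : ℕ => tau n) (f := f) (by simp) b
    (fun t ht => (hf t ht).differentiableAt)
    (hf'.integrableOn_Icc.congr_fun (fun t ht => (hd ht).symm) measurableSet_Icc)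
  simp only [sum_Icc_tau_eq_divSum] at h
  rw [Finset.Icc_eq_cons_Ioc (Nat.zero_le _), Finset.sum_cons, ArithmeticFunction.map_zero, mul_zero,
    zero_add] at h
  have hM : IntervalIntegrable (fun t => f' t * divMain t) volume 1 b :=
    (hf'.mul (continuousOn_divMain one_pos)).intervalIntegrable_of_Icc hb
  have h2 : ∫ t in Set.Ioc 1 b, deriv f t * divSum t =
      (∫ t in (1 : ℝ)..b, f' t * divMain t) + ∫ t in (1 : ℝ)..b, f' t * divErr t := by
    rw [← intervalIntegral.integral_add hM
      (intervalIntegrable_mul_divErr one_pos hb hf'), intervalIntegral.integral_of_le hb]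
    refine setIntegral_congr_fun measurableSet_Ioc fun t ht => ?_
    simp only [hd (Set.Ioc_subset_Icc_self ht), divSum_eq]
    ring
  have h3 : ∫ t in (1 : ℝ)..b, f' t * divMain t = P b - P 1 :=
    intervalIntegral.integral_eq_sub_of_hasDerivAt
      (fun t ht => hP t (by rwa [Set.uIcc_of_le hb] at ht)) hM
  rw [h2, h3, divSum_eq] at h
  rw [Finset.sum_congr rfl fun a _ => mul_comm (tau a) (f a), h]
  ring

/-- `∫_1^x Δ(t) / t ^ 2 dt` for the divisor error term `Δ`. -/
noncomputable def divErrInt (x : ℝ) : ℝ := ∫ t in (1 : ℝ)..x, 1 / t ^ 2 * divErr t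

/-- `∫_1^x Δ(t) log t / t ^ 2 dt` for the divisor error term `Δ`. -/
noncomputable def divErrLogInt (x : ℝ) : ℝ := ∫ t in (1 : ℝ)..x, Real.log t / t ^ 2 * divErr t

theorem continuousOn_log_Icc_one (b : ℝ) : ContinuousOn Real.log (Set.Icc 1 b) :=
  Real.continuousOn_log.mono fun t ht => (zero_lt_one.trans_le ht.1).ne'

theorem sum_tau_div {b : ℝ} (hb : 1 ≤ b) :
    ∑ a ∈ Finset.Ioc 0 ⌊b⌋₊, tau a * (1 / a) =
      Real.log b ^ 2 / 2 + 2 * Real.eulerMascheroniConstant * Real.log b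
        + (2 * Real.eulerMascheroniConstant - 1) + divErrInt b + divErr b / b := by
  have hne : ∀ t ∈ Set.Icc 1 b, t ^ 2 ≠ 0 := fun _ ht =>
    pow_ne_zero _ (by linarith [ht.1])
  rw [sum_tau_mul_eq (f := fun t => 1 / t) (f' := fun t => -(1 / t ^ 2))
    (P := fun t => -(Real.log t ^ 2 / 2 + (2 * Real.eulerMascheroniConstant - 1) * Real.log t)) hb
    ?_ ?_ ?_]
  · have : (∫ t in (1 : ℝ)..b, -(1 / t ^ 2) * divErr t) = -divErrInt b := by
      rw [divErrInt, ← intervalIntegral.integral_neg]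
      simp only [neg_mul]
    rw [this, divMain]
    have hb0 : b ≠ 0 := by linarith
    simp only [Real.log_one]
    field_simp
    ring
  · intro t ht
    have h0 : t ≠ 0 := by linarith [ht.1]
    refine ((hasDerivAt_const t 1).div (hasDerivAt_id t) h0).congr_deriv ?_
    simp only [id]
    field_simp
    simp
  · exact (continuousOn_const.div (by fun_prop) hne).neg
  · intro t ht
    have h0 : t ≠ 0 := by linarith [ht.1]
    refine (((((Real.hasDerivAt_log h0).pow 2).div_const 2).add
      ((Real.hasDerivAt_log h0).const_mul (2 * Real.eulerMascheroniConstant - 1))).neg).congr_deriv ?_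
    simp only [divMain]
    push_cast
    field_simp

theorem sum_tau_log_div {b : ℝ} (hb : 1 ≤ b) :
    ∑ a ∈ Finset.Ioc 0 ⌊b⌋₊, tau a * (Real.log a / a) =
      Real.log b ^ 3 / 3 + Real.eulerMascheroniConstant * Real.log b ^ 2
        + (divErrLogInt b - divErrInt b) + divErr b * Real.log b / b := by
  have hne : ∀ t ∈ Set.Icc 1 b, t ^ 2 ≠ 0 := fun _ ht =>
    pow_ne_zero _ (by linarith [ht.1])
  have hc := continuousOn_log_Icc_one b
  rw [sum_tau_mul_eq (f := fun t => Real.log t / t) (f' := fun t => (1 - Real.log t) / t ^ 2)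
    (P := fun t => Real.log t ^ 2 / 2 + (2 * Real.eulerMascheroniConstant - 1) * Real.log t
      - Real.log t ^ 3 / 3 - (2 * Real.eulerMascheroniConstant - 1) * Real.log t ^ 2 / 2) hb
    ?_ ?_ ?_]
  · have i1 : IntervalIntegrable (fun t => 1 / t ^ 2 * divErr t) volume 1 b :=
      intervalIntegrable_mul_divErr one_pos hb (continuousOn_const.div (by fun_prop) hne)
    have i2 : IntervalIntegrable (fun t => Real.log t / t ^ 2 * divErr t) volume 1 b :=
      intervalIntegrable_mul_divErr one_pos hb (hc.div (by fun_prop) hne)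
    have : (∫ t in (1 : ℝ)..b, (1 - Real.log t) / t ^ 2 * divErr t) =
        divErrInt b - divErrLogInt b := by
      rw [divErrInt, divErrLogInt, ← intervalIntegral.integral_sub i1 i2]
      congr 1
      ext t
      ring
    rw [this, divMain]
    have hb0 : b ≠ 0 := by linarith
    simp only [Real.log_one]
    field_simp
    ring
  · intro t ht
    have h0 : t ≠ 0 := by linarith [ht.1]
    refine ((Real.hasDerivAt_log h0).div (hasDerivAt_id t) h0).congr_deriv ?_
    simp only [id]
    field_simp
  · exact (continuousOn_const.sub hc).div (by fun_prop) hne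
  · intro t ht
    have h0 : t ≠ 0 := by linarith [ht.1]
    have hl := Real.hasDerivAt_log h0
    refine ((((((hl.pow 2).div_const 2).add
      (hl.const_mul (2 * Real.eulerMascheroniConstant - 1))).sub ((hl.pow 3).div_const 3)).sub
      (((hl.pow 2).const_mul (2 * Real.eulerMascheroniConstant - 1)).div_const 2))).congr_deriv ?_
    simp only [divMain]
    push_cast
    field_simp
    ring

/-- Only an upper bound is needed, because this sum enters the error term alone. Here `Δ` is
estimated at once by `√t + 1/4`. -/
theorem sum_tau_div_sqrt_le {b : ℝ} (hb : 1 ≤ b) :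
    ∑ a ∈ Finset.Ioc 0 ⌊b⌋₊, tau a * (1 / √a) ≤
      √b * (2 * Real.log b + 4 * Real.eulerMascheroniConstant - 4)
        + (4 - 2 * Real.eulerMascheroniConstant) + Real.log b / 2 + 1 / 4 := by
  have hs : ∀ t ∈ Set.Icc 1 b, 0 < √t := fun t ht => Real.sqrt_pos.2 (by linarith [ht.1])
  have hcont : ContinuousOn (fun t => 1 / (2 * (t * √t))) (Set.Icc 1 b) :=
    continuousOn_const.div (by fun_prop) fun t ht => by
      have := hs t ht
      have : 0 < t := by linarith [ht.1]
      positivity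
  rw [sum_tau_mul_eq (f := fun t => 1 / √t) (f' := fun t => -(1 / (2 * (t * √t))))
    (P := fun t => -(√t * (Real.log t + (2 * Real.eulerMascheroniConstant - 1) - 2))) hb
    ?_ hcont.neg ?_]
  · have hint : -(∫ t in (1 : ℝ)..b, -(1 / (2 * (t * √t))) * divErr t) ≤
        Real.log b / 2 + 1 / 4 * (1 - 1 / √b) := by
      rw [← intervalIntegral.integral_neg]
      have h1 : ∀ t ∈ Set.Icc 1 b, HasDerivAt (fun t => Real.log t / 2 + 1 / 4 * (1 - 1 / √t))
          (1 / (2 * (t * √t)) * (√t + 1 / 4)) t := by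
        intro t ht
        have h0 : 0 < t := by linarith [ht.1]
        have h2 := hs t ht
        refine (((Real.hasDerivAt_log h0.ne').div_const 2).add
          ((((hasDerivAt_const t 1).div (Real.hasDerivAt_sqrt h0.ne') h2.ne').const_sub 1).const_mul
            (1 / 4))).congr_deriv ?_
        obtain ⟨s, hs0, rfl⟩ : ∃ s, 0 < s ∧ t = s ^ 2 := ⟨√t, h2, (Real.sq_sqrt h0.le).symm⟩
        rw [Real.sqrt_sq hs0.le]
        field_simp
        ring
      have hcont2 : ContinuousOn (fun t => 1 / (2 * (t * √t)) * (√t + 1 / 4)) (Set.Icc 1 b) :=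
        hcont.mul (by fun_prop)
      have h2 := intervalIntegral.integral_eq_sub_of_hasDerivAt
        (fun t ht => h1 t (by rwa [Set.uIcc_of_le hb] at ht)) (hcont2.intervalIntegrable_of_Icc hb)
      have h3 : ∫ t in (1 : ℝ)..b, -(-(1 / (2 * (t * √t))) * divErr t) ≤
          ∫ t in (1 : ℝ)..b, 1 / (2 * (t * √t)) * (√t + 1 / 4) := by
        refine intervalIntegral.integral_mono_on hb
          (intervalIntegrable_mul_divErr one_pos hb hcont.neg).neg
          (hcont2.intervalIntegrable_of_Icc hb) fun t ht => ?_
        have h0 : 0 < t := by linarith [ht.1]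
        have := hs t ht
        rw [neg_mul, neg_neg]
        exact mul_le_mul_of_nonneg_left (divErr_le ht.1) (by positivity)
      refine h3.trans (h2.le.trans ?_)
      simp
    have hb0 : 0 < b := by linarith
    obtain ⟨s, hs0, rfl⟩ : ∃ s, 0 < s ∧ b = s ^ 2 :=
      ⟨√b, Real.sqrt_pos.2 hb0, (Real.sq_sqrt hb0.le).symm⟩
    have herr := divErr_le hb
    rw [Real.sqrt_sq hs0.le] at *
    have h4 : 1 / s * divErr (s ^ 2) ≤ 1 + 1 / 4 * (1 / s) := by
      have := mul_le_mul_of_nonneg_left herr (by positivity : 0 ≤ 1 / s)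
      refine this.trans (le_of_eq ?_)
      field_simp
    have h5 : 1 / s * divMain (s ^ 2) = s * Real.log (s ^ 2) +
        (2 * Real.eulerMascheroniConstant - 1) * s := by
      rw [divMain]
      field_simp
    rw [h5]
    simp only [Real.log_one, Real.sqrt_one]
    rw [sub_eq_add_neg _ (∫ t in (1 : ℝ)..s ^ 2, _)]
    linarith
  · intro t ht
    have h0 : 0 < t := by linarith [ht.1]
    have h2 := hs t ht
    refine ((hasDerivAt_const t 1).div (Real.hasDerivAt_sqrt h0.ne') h2.ne').congr_deriv ?_
    obtain ⟨s, hs0, rfl⟩ : ∃ s, 0 < s ∧ t = s ^ 2 := ⟨√t, h2, (Real.sq_sqrt h0.le).symm⟩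
    rw [Real.sqrt_sq hs0.le]
    field_simp
    simp
  · intro t ht
    have h0 : 0 < t := by linarith [ht.1]
    have h2 := hs t ht
    refine ((Real.hasDerivAt_sqrt h0.ne').mul
      (((Real.hasDerivAt_log h0.ne').add_const _).sub_const 2)).neg.congr_deriv ?_
    rw [divMain]
    obtain ⟨s, hs0, rfl⟩ : ∃ s, 0 < s ∧ t = s ^ 2 := ⟨√t, h2, (Real.sq_sqrt h0.le).symm⟩
    rw [Real.sqrt_sq hs0.le]
    field_simp
    ring

/-! ### The asymptotic formula with integral constants -/

/-- An antiderivative of `(√v + 1 / 4) * (A - log v) / v ^ 2`. -/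
noncomputable def weightPrim (A v : ℝ) : ℝ :=
  (4 - 2 * A + 2 * Real.log v) / √v + 1 / 4 * ((1 - (A - Real.log v)) / v)

theorem hasDerivAt_weightPrim (A : ℝ) {v : ℝ} (hv : 0 < v) :
    HasDerivAt (weightPrim A) ((A - Real.log v) / v ^ 2 * (√v + 1 / 4)) v := by
  have hs := Real.sqrt_pos.2 hv
  have hl := Real.hasDerivAt_log hv.ne'
  refine ((((hl.const_mul 2).const_add (4 - 2 * A)).div (Real.hasDerivAt_sqrt hv.ne') hs.ne').add
    ((((hl.const_sub A).const_sub 1).div (hasDerivAt_id v) hv.ne').const_mul (1 / 4))).congr_deriv ?_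
  simp only [id]
  obtain ⟨s, hs0, rfl⟩ : ∃ s, 0 < s ∧ v = s ^ 2 := ⟨√v, hs, (Real.sq_sqrt hv.le).symm⟩
  rw [Real.sqrt_sq hs0.le]
  field_simp
  ring

theorem continuousOn_sub_log_div_sq (A : ℝ) {a b : ℝ} (ha : 0 < a) :
    ContinuousOn (fun v => (A - Real.log v) / v ^ 2) (Set.Icc a b) :=
  (continuousOn_const.sub (Real.continuousOn_log.mono fun t ht => (ha.trans_le ht.1).ne')).div
    (by fun_prop) fun t ht => pow_ne_zero _ (ha.trans_le ht.1).ne'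

theorem integral_weight (A : ℝ) {a b : ℝ} (ha : 0 < a) (hab : a ≤ b) :
    ∫ v in a..b, (A - Real.log v) / v ^ 2 * (√v + 1 / 4) = weightPrim A b - weightPrim A a := by
  refine intervalIntegral.integral_eq_sub_of_hasDerivAt (fun v hv => ?_) ?_
  · rw [Set.uIcc_of_le hab] at hv
    exact hasDerivAt_weightPrim A (ha.trans_le hv.1)
  · exact ((continuousOn_sub_log_div_sq A ha).mul (by fun_prop)).intervalIntegrable_of_Icc hab

/-- The factor `s` is used with the values `1` and `-1`, to cover weights on either side of the zero
of `A - log v`. -/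
theorem abs_integral_mul_divErr_le {g : ℝ → ℝ} {A a b : ℝ} (ha : 1 ≤ a) (hab : a ≤ b) (s : ℝ)
    (hg : ∀ v ∈ Set.Icc a b, |g v| ≤ s * ((A - Real.log v) / v ^ 2)) :
    |∫ v in a..b, g v * divErr v| ≤ s * (weightPrim A b - weightPrim A a) := by
  have ha0 : 0 < a := by linarith
  rw [← integral_weight A ha0 hab, ← intervalIntegral.integral_const_mul,
    ← Real.norm_eq_abs]
  refine intervalIntegral.norm_integral_le_of_norm_le hab ?_ ?_
  · refine Filter.Eventually.of_forall fun v hv => ?_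
    have hv' := Set.Ioc_subset_Icc_self hv
    rw [Real.norm_eq_abs, abs_mul, ← mul_assoc]
    exact mul_le_mul (hg v hv') (abs_divErr_le (ha.trans hv'.1)) (abs_nonneg _)
      ((abs_nonneg _).trans (hg v hv'))
  · exact (continuousOn_const.mul ((continuousOn_sub_log_div_sq A ha0).mul
      (by fun_prop))).intervalIntegrable_of_Icc hab

/-- The bound must not depend on `T`, which later tends to infinity. The integral is split at `x =
y⁴`: the weight is nonnegative before, and beyond it `|log x + 2γ - log v| ≤ log v - (log x - 2γ)`.
-/
theorem abs_integral_weight_divErr_le {y T : ℝ} (hy : 1 ≤ y) (hT : y ^ 4 ≤ T) :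
    |∫ v in y ^ 2..T, (4 * Real.log y + 2 * Real.eulerMascheroniConstant - Real.log v) / v ^ 2 *
        divErr v| ≤
      (4 * Real.log y + 4 * Real.eulerMascheroniConstant - 4) / y + 8 / y ^ 2
        + 1 / 4 * ((2 * Real.log y + 2 * Real.eulerMascheroniConstant - 1) / y ^ 2) + 1 / 2 / y ^ 4 := by
  set γ := Real.eulerMascheroniConstant
  have hγ : 0 < γ := by
    have : 1 / 2 < γ := Real.one_half_lt_eulerMascheroniConstant
    linarith
  set A := 4 * Real.log y + 2 * γ with hA
  have hy0 : 0 < y := by linarith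
  have h1 : 1 ≤ y ^ 2 := one_le_pow₀ hy
  have h12 : y ^ 2 ≤ y ^ 4 := pow_le_pow_right₀ hy (by norm_num)
  have hc := fun {a b : ℝ} (ha : 0 < a) => continuousOn_sub_log_div_sq A (a := a) (b := b) ha
  rw [← intervalIntegral.integral_add_adjacent_intervals
    (intervalIntegrable_mul_divErr (by positivity) h12 (hc (by positivity)))
    (intervalIntegrable_mul_divErr (by positivity) hT (hc (by positivity)))]
  have hl4 : Real.log (y ^ 4) = 4 * Real.log y := by rw [Real.log_pow]; norm_num
  have hl2 : Real.log (y ^ 2) = 2 * Real.log y := by rw [Real.log_pow]; norm_num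
  have b1 := abs_integral_mul_divErr_le (g := fun v => (A - Real.log v) / v ^ 2) (A := A)
    h1 h12 1 (fun v hv => by
      have hv0 : 0 < v := by linarith [hv.1]
      have := Real.log_le_log hv0 hv.2
      rw [hl4] at this
      rw [one_mul, abs_of_nonneg (div_nonneg (by linarith) (by positivity))])
  have b2 := abs_integral_mul_divErr_le (g := fun v => (A - Real.log v) / v ^ 2)
    (A := 4 * Real.log y - 2 * γ) (h1.trans h12) hT (-1) (fun v hv => by
      have hv0 : 0 < v := by linarith [hv.1]
      have := Real.log_le_log (by positivity) hv.1
      rw [hl4] at this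
      rw [neg_one_mul, abs_div, abs_of_pos (by positivity : 0 < v ^ 2), ← neg_div]
      refine div_le_div_of_nonneg_right (abs_le.2 ⟨by linarith, by linarith⟩) (by positivity))
  refine (abs_add_le _ _).trans ((add_le_add b1 b2).trans ?_)
  have hT0 : 0 < T := lt_of_lt_of_le (by positivity) hT
  have hlT := Real.log_le_log (by positivity) hT
  rw [hl4] at hlT
  have p1 : 0 ≤ (4 - 2 * (4 * Real.log y - 2 * γ) + 2 * Real.log T) / √T :=
    div_nonneg (by linarith) (Real.sqrt_nonneg _)
  have p2 : 0 ≤ (1 - (4 * Real.log y - 2 * γ - Real.log T)) / T :=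
    div_nonneg (by linarith) hT0.le
  have s4 : √(y ^ 4) = y ^ 2 := by rw [show y ^ 4 = (y ^ 2) ^ 2 by ring, Real.sqrt_sq (by positivity)]
  have s2 : √(y ^ 2) = y := Real.sqrt_sq hy0.le
  have e : 1 * (weightPrim A (y ^ 4) - weightPrim A (y ^ 2)) +
      weightPrim (4 * Real.log y - 2 * γ) (y ^ 4) =
      (4 * Real.log y + 4 * γ - 4) / y + 8 / y ^ 2
        + 1 / 4 * ((2 * Real.log y + 2 * γ - 1) / y ^ 2) + 1 / 2 / y ^ 4 := by
    simp only [weightPrim, s4, s2, hl4, hl2, hA]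
    field_simp
    ring
  -- The endpoint term at `T` enters with a minus sign and can be dropped.
  have e2 : 0 ≤ weightPrim (4 * Real.log y - 2 * γ) T := by
    unfold weightPrim
    linarith
  linarith

/-- The main term for the summatory function of `d₄` in terms of the logarithm of `x` and the
values `i`, `j` of `divErrInt`, `divErrLogInt - divErrInt`. -/
noncomputable def mainPoly (γ l i j : ℝ) : ℝ :=
  2 * ((l + (2 * γ - 1)) * ((l / 2) ^ 2 / 2 + 2 * γ * (l / 2) + (2 * γ - 1) + i)
    - ((l / 2) ^ 3 / 3 + γ * (l / 2) ^ 2 + j)) - (l / 2 + (2 * γ - 1)) ^ 2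

/-- An exact identity for `x = y⁴`, a substitution that turns `√x` and `x^{3/4}` into monomials. The
boundary terms of the two Abel summations contribute `2 y² (2 log y + 2γ - 1) Δ(y²)`, exactly the
cross term of `D(y²)²`; so only `Δ(y²)²` survives. The integrals up to `y²` are completed to `T`,
and the difference is the weighted integral. -/
theorem sumDk_four_eq_main_add {y T : ℝ} (hy : 1 ≤ y) (hT : y ^ 4 ≤ T) :
    sumDk 4 (y ^ 4) = y ^ 4 * mainPoly Real.eulerMascheroniConstant (4 * Real.log y) (divErrInt T)
        (divErrLogInt T - divErrInt T)
      + 2 * ∑ a ∈ Finset.Ioc 0 ⌊y ^ 2⌋₊, tau a * divErr (y ^ 4 / a)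
      - 2 * y ^ 4 * (∫ v in y ^ 2..T,
        (4 * Real.log y + 2 * Real.eulerMascheroniConstant - Real.log v) / v ^ 2 * divErr v)
      - divErr (y ^ 2) ^ 2 := by
  set γ := Real.eulerMascheroniConstant with hγ
  have hy0 : 0 < y := by linarith
  have h1 : 1 ≤ y ^ 2 := one_le_pow₀ hy
  have h12 : y ^ 2 ≤ y ^ 4 := pow_le_pow_right₀ hy (by norm_num)
  have h1T : 1 ≤ T := by linarith
  have h2T : y ^ 2 ≤ T := by linarith
  have s4 : √(y ^ 4) = y ^ 2 := by rw [show y ^ 4 = (y ^ 2) ^ 2 by ring, Real.sqrt_sq (by positivity)]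
  have hl4 : Real.log (y ^ 4) = 4 * Real.log y := by rw [Real.log_pow]; norm_num
  have hl2 : Real.log (y ^ 2) = 2 * Real.log y := by rw [Real.log_pow]; norm_num
  have hc : ∀ a b : ℝ, 0 < a → ContinuousOn (fun v : ℝ => 1 / v ^ 2) (Set.Icc a b) := fun a b ha =>
    continuousOn_const.div (by fun_prop) fun t ht => pow_ne_zero _ (ha.trans_le ht.1).ne'
  have hcl : ∀ a b : ℝ, 0 < a → ContinuousOn (fun v : ℝ => Real.log v / v ^ 2) (Set.Icc a b) :=
    fun a b ha => (Real.continuousOn_log.mono fun t ht => (ha.trans_le ht.1).ne').div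
      (by fun_prop) fun t ht => pow_ne_zero _ (ha.trans_le ht.1).ne'
  have i1 : IntervalIntegrable (fun v => 1 / v ^ 2 * divErr v) volume 1 (y ^ 2) :=
    intervalIntegrable_mul_divErr one_pos h1 (hc _ _ one_pos)
  have i2 : IntervalIntegrable (fun v => 1 / v ^ 2 * divErr v) volume (y ^ 2) T :=
    intervalIntegrable_mul_divErr (by positivity) h2T (hc _ _ (by positivity))
  have j1 : IntervalIntegrable (fun v => Real.log v / v ^ 2 * divErr v) volume 1 (y ^ 2) :=
    intervalIntegrable_mul_divErr one_pos h1 (hcl _ _ one_pos)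
  have j2 : IntervalIntegrable (fun v => Real.log v / v ^ 2 * divErr v) volume (y ^ 2) T :=
    intervalIntegrable_mul_divErr (by positivity) h2T (hcl _ _ (by positivity))
  have eI : divErrInt T = divErrInt (y ^ 2) + ∫ v in y ^ 2..T, 1 / v ^ 2 * divErr v :=
    (intervalIntegral.integral_add_adjacent_intervals i1 i2).symm
  have eJ : divErrLogInt T = divErrLogInt (y ^ 2) +
      ∫ v in y ^ 2..T, Real.log v / v ^ 2 * divErr v :=
    (intervalIntegral.integral_add_adjacent_intervals j1 j2).symm
  have eW : (∫ v in y ^ 2..T, (4 * Real.log y + 2 * γ - Real.log v) / v ^ 2 * divErr v) =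
      (4 * Real.log y + 2 * γ) * (∫ v in y ^ 2..T, 1 / v ^ 2 * divErr v) -
      ∫ v in y ^ 2..T, Real.log v / v ^ 2 * divErr v := by
    rw [← intervalIntegral.integral_const_mul, ← intervalIntegral.integral_sub (i2.const_mul _) j2]
    congr 1
    ext v
    ring
  have hM : ∑ a ∈ Finset.Ioc 0 ⌊y ^ 2⌋₊, tau a * divSum (y ^ 4 / a) =
      y ^ 4 * ((4 * Real.log y + (2 * γ - 1)) * ∑ a ∈ Finset.Ioc 0 ⌊y ^ 2⌋₊, tau a * (1 / a)
        - ∑ a ∈ Finset.Ioc 0 ⌊y ^ 2⌋₊, tau a * (Real.log a / a))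
      + ∑ a ∈ Finset.Ioc 0 ⌊y ^ 2⌋₊, tau a * divErr (y ^ 4 / a) := by
    rw [Finset.mul_sum, ← Finset.sum_sub_distrib, Finset.mul_sum, ← Finset.sum_add_distrib]
    refine Finset.sum_congr rfl fun a ha => ?_
    have ha0 : (0 : ℝ) < a := by exact_mod_cast (Finset.mem_Ioc.1 ha).1
    rw [divSum_eq, divMain, Real.log_div (by positivity) ha0.ne', hl4]
    ring
  rw [sumDk_four_hyperbola (by positivity), s4, hM, sum_tau_div h1, sum_tau_log_div h1,
    divSum_eq (y ^ 2), divMain, hl2, eW, eI, eJ, mainPoly]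
  field_simp
  ring

/-- Termwise, `|Δ(y⁴/a)| ≤ y²/√a + 1/4`; what remains are the sums of `τ(a)/√a` and of `τ(a)` up to
`y²`. -/
theorem abs_sum_tau_mul_divErr_le {y : ℝ} (hy : 1 ≤ y) :
    |∑ a ∈ Finset.Ioc 0 ⌊y ^ 2⌋₊, tau a * divErr (y ^ 4 / a)| ≤
      y ^ 2 * (y * (4 * Real.log y + 4 * Real.eulerMascheroniConstant - 4)
        + (4 - 2 * Real.eulerMascheroniConstant) + Real.log y + 1 / 4)
      + 1 / 4 * (y ^ 2 * (2 * Real.log y + (2 * Real.eulerMascheroniConstant - 1)) + y + 1 / 4) := by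
  have hy0 : 0 < y := by linarith
  have h1 : 1 ≤ y ^ 2 := one_le_pow₀ hy
  have h12 : y ^ 2 ≤ y ^ 4 := pow_le_pow_right₀ hy (by norm_num)
  have s4 : √(y ^ 4) = y ^ 2 := by rw [show y ^ 4 = (y ^ 2) ^ 2 by ring, Real.sqrt_sq (by positivity)]
  have s2 : √(y ^ 2) = y := Real.sqrt_sq hy0.le
  have hl2 : Real.log (y ^ 2) = 2 * Real.log y := by rw [Real.log_pow]; norm_num
  have hQ := sum_tau_div_sqrt_le h1
  rw [s2, hl2] at hQ
  have hD : divSum (y ^ 2) ≤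
      y ^ 2 * (2 * Real.log y + (2 * Real.eulerMascheroniConstant - 1)) + y + 1 / 4 := by
    have := divErr_le h1
    rw [s2] at this
    rw [divSum_eq, divMain, hl2]
    linarith
  have : |∑ a ∈ Finset.Ioc 0 ⌊y ^ 2⌋₊, tau a * divErr (y ^ 4 / a)| ≤
      y ^ 2 * ∑ a ∈ Finset.Ioc 0 ⌊y ^ 2⌋₊, tau a * (1 / √a) + 1 / 4 * divSum (y ^ 2) := by
    rw [divSum, Finset.mul_sum, Finset.mul_sum, ← Finset.sum_add_distrib]
    refine (Finset.abs_sum_le_sum_abs _ _).trans (Finset.sum_le_sum fun a ha => ?_)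
    have ha' := Finset.mem_Ioc.1 ha
    have ha0 : (0 : ℝ) < a := by exact_mod_cast ha'.1
    have hay : (a : ℝ) ≤ y ^ 2 := (Nat.le_floor_iff (by positivity)).1 ha'.2
    rw [abs_mul, abs_of_nonneg (tau_nonneg a)]
    have := mul_le_mul_of_nonneg_left (abs_divErr_le (x := y ^ 4 / a)
      ((one_le_div ha0).2 (hay.trans h12))) (tau_nonneg a)
    rw [Real.sqrt_div (by positivity), s4] at this
    refine this.trans (le_of_eq ?_)
    ring
  refine this.trans (add_le_add (mul_le_mul_of_nonneg_left (hQ.trans (le_of_eq ?_)) (by positivity))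
    (mul_le_mul_of_nonneg_left hD (by norm_num)))
  ring

theorem abs_sumDk_four_sub_main_le {y T : ℝ} (hy : 1 ≤ y) (hT : y ^ 4 ≤ T) :
    |sumDk 4 (y ^ 4) - y ^ 4 * mainPoly Real.eulerMascheroniConstant (4 * Real.log y) (divErrInt T)
        (divErrLogInt T - divErrInt T)| ≤
      4 * y ^ 3 * (4 * Real.log y + 4 * Real.eulerMascheroniConstant - 4)
        + y ^ 2 * (4 * Real.log y - 2 * Real.eulerMascheroniConstant + 24.5) + y + 19 / 16 := by
  have hy0 : 0 < y := by linarith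
  have h1 : 1 ≤ y ^ 2 := one_le_pow₀ hy
  have hW := abs_integral_weight_divErr_le hy hT
  have hS := abs_sum_tau_mul_divErr_le hy
  have hE := abs_divErr_le h1
  rw [Real.sqrt_sq hy0.le] at hE
  have hE2 : divErr (y ^ 2) ^ 2 ≤ (y + 1 / 4) ^ 2 := sq_le_sq' (abs_le.1 hE).1 (abs_le.1 hE).2
  rw [sumDk_four_eq_main_add hy hT]
  generalize (∫ v in y ^ 2..T, (4 * Real.log y + 2 * Real.eulerMascheroniConstant - Real.log v) /
    v ^ 2 * divErr v) = W at *
  generalize ∑ a ∈ Finset.Ioc 0 ⌊y ^ 2⌋₊, tau a * divErr (y ^ 4 / a) = S at *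
  set γ := Real.eulerMascheroniConstant
  have hW2 : |y ^ 4 * W| ≤ y ^ 3 * (4 * Real.log y + 4 * γ - 4) + 8 * y ^ 2
      + 1 / 4 * (y ^ 2 * (2 * Real.log y + 2 * γ - 1)) + 1 / 2 := by
    rw [abs_mul, abs_of_pos (by positivity : 0 < y ^ 4)]
    refine (mul_le_mul_of_nonneg_left hW (by positivity)).trans (le_of_eq ?_)
    field_simp
  rw [abs_le] at hW2 hS ⊢
  constructor <;> nlinarith [sq_nonneg (divErr (y ^ 2))]

/-! ### Identification of the integrals with Stieltjes constants -/

/-- The arithmetic function `log n ^ k / n`. -/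
noncomputable def logPowDiv (k : ℕ) : ArithmeticFunction ℝ :=
  ⟨fun n => Real.log n ^ k / n, by simp⟩

/-- `∑_{m ≤ N} log m ^ k / m`. -/
noncomputable def logHarmonic (k N : ℕ) : ℝ := ∑ m ∈ Finset.Ioc 0 N, logPowDiv k m

theorem logPowDiv_apply (k n : ℕ) : logPowDiv k n = Real.log n ^ k / n := rfl

theorem stieltjesSeq_eq (k N : ℕ) :
    stieltjesSeq k N = logHarmonic k N - Real.log N ^ (k + 1) / (k + 1) := by
  unfold stieltjesSeq logHarmonic
  congr 1

theorem logHarmonic_zero_eq (N : ℕ) : logHarmonic 0 N = harmonic N := by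
  rw [← sum_inv_Ioc_eq_harmonic]
  simp [logHarmonic, logPowDiv_apply]

theorem logPowDiv_zero_mul_zero (n : ℕ) : (logPowDiv 0 * logPowDiv 0) n = tau n * (1 / n) := by
  rw [tau, ArithmeticFunction.mul_apply, ArithmeticFunction.mul_apply, Finset.sum_mul]
  refine Finset.sum_congr rfl fun p hp => ?_
  obtain ⟨h1, h2⟩ := Nat.mem_divisorsAntidiagonal.1 hp
  have ha : p.1 ≠ 0 := by rintro h; simp [h] at h1; omega
  have hb : p.2 ≠ 0 := by rintro h; simp [h] at h1; omega
  rw [zeta_real_apply ha, zeta_real_apply hb, logPowDiv_apply, logPowDiv_apply, ← h1]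
  push_cast
  field_simp

theorem two_mul_logPowDiv_zero_mul_one (n : ℕ) :
    2 * (logPowDiv 0 * logPowDiv 1) n = tau n * (Real.log n / n) := by
  have hc : 2 * (logPowDiv 0 * logPowDiv 1) n =
      (logPowDiv 0 * logPowDiv 1) n + (logPowDiv 1 * logPowDiv 0) n := by
    rw [mul_comm (logPowDiv 1)]
    ring
  rw [hc, tau, ArithmeticFunction.mul_apply, ArithmeticFunction.mul_apply,
    ArithmeticFunction.mul_apply, Finset.sum_mul, ← Finset.sum_add_distrib]
  refine Finset.sum_congr rfl fun p hp => ?_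
  obtain ⟨h1, h2⟩ := Nat.mem_divisorsAntidiagonal.1 hp
  have ha : p.1 ≠ 0 := by rintro h; simp [h] at h1; omega
  have hb : p.2 ≠ 0 := by rintro h; simp [h] at h1; omega
  have ha' : (p.1 : ℝ) ≠ 0 := by exact_mod_cast ha
  have hb' : (p.2 : ℝ) ≠ 0 := by exact_mod_cast hb
  simp only [zeta_real_apply ha, zeta_real_apply hb, logPowDiv_apply, ← h1]
  push_cast
  rw [Real.log_mul ha' hb']
  field_simp
  ring

/-- The rate `1/√y` is far from the truth, but any power saving absorbs the powers of `log N` that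
multiply it below. -/
theorem abs_logHarmonic_zero_sub_le {y : ℝ} (hy : 1 ≤ y) :
    |logHarmonic 0 ⌊y⌋₊ - (Real.log y + Real.eulerMascheroniConstant)| ≤ 2 / √y := by
  have hn : 1 ≤ ⌊y⌋₊ := (Nat.one_le_floor_iff _).2 hy
  have h1 := harmonic_le ⌊y⌋₊ hn
  have h2 := le_harmonic ⌊y⌋₊
  have hle := Nat.floor_le (by linarith : 0 ≤ y)
  have hlt := Nat.lt_floor_add_one y
  rw [logHarmonic_zero_eq]
  have hnr : (1 : ℝ) ≤ (⌊y⌋₊ : ℝ) := by exact_mod_cast hn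
  generalize (harmonic ⌊y⌋₊ : ℝ) = H at *
  generalize (⌊y⌋₊ : ℝ) = n at *
  have hs : 1 / n ≤ 2 / √y := by
    rw [div_le_div_iff₀ (by linarith) (Real.sqrt_pos.2 (by linarith))]
    have : √y ≤ y := by
      rw [Real.sqrt_le_left (by linarith)]
      nlinarith
    linarith
  have hl1 := Real.log_le_log (by linarith) hle
  have hl2 : -(1 / n) ≤ Real.log (n + 1 / 2) - Real.log y := by
    rw [← Real.log_div (by linarith) (by linarith)]
    refine le_trans ?_ (Real.one_sub_inv_le_log_of_pos (div_pos (by linarith) (by linarith)))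
    rw [inv_div, neg_le_sub_iff_le_add, div_le_iff₀ (by linarith)]
    have : 1 / n * n = 1 := by field_simp
    have : 0 < 1 / n := by positivity
    nlinarith
  have hh : 1 / (2 * n) ≤ 1 / n := div_le_div_of_nonneg_left (by norm_num) (by linarith) (by linarith)
  exact abs_le.2 ⟨by linarith, by linarith⟩

theorem abs_logHarmonic_one_sub_le {y : ℝ} (hy : 10 ≤ y) :
    |logHarmonic 1 ⌊y⌋₊ - (Real.log y ^ 2 / 2 + stieltjesConstant 1)| ≤ 10 / √y := by
  have hn : 10 ≤ ⌊y⌋₊ := (Nat.le_floor_iff (by linarith)).2 (by exact_mod_cast hy)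
  have h1 := (stieltjes_one_bound hn).2
  have hle := Nat.floor_le (by linarith : 0 ≤ y)
  have hlt := Nat.lt_floor_add_one y
  rw [stieltjesSeq_eq] at h1
  have hnr : (10 : ℝ) ≤ (⌊y⌋₊ : ℝ) := by exact_mod_cast hn
  generalize logHarmonic 1 ⌊y⌋₊ = H at *
  generalize (⌊y⌋₊ : ℝ) = n at *
  have hln1 : 1 ≤ Real.log n := by
    rw [Real.le_log_iff_exp_le (by linarith)]
    linarith [Real.exp_one_lt_d9]
  have hlny := Real.log_le_log (by linarith) hle
  obtain ⟨-, hlys⟩ := log_nonneg_and_le_two_mul_sqrt (by linarith : 1 ≤ y)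
  have hdiff : Real.log y - Real.log n ≤ 1 / n := by
    rw [← Real.log_div (by linarith) (by linarith)]
    refine (Real.log_le_sub_one_of_pos (div_pos (by linarith) (by linarith))).trans ?_
    rw [div_sub_one (by linarith)]
    exact div_le_div_of_nonneg_right (by linarith) (by linarith)
  have e1 : 7 / (2160 * (n - 1) ^ 3) ≤ 0.1 * (1 / n) := by
    rw [mul_one_div, div_le_div_iff₀ (by have : 0 < n - 1 := by linarith
                                         positivity) (by linarith)]
    nlinarith [pow_pos (by linarith : 0 < n - 1) 2, pow_pos (by linarith : 0 < n - 1) 3]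
  have e2 : |(1 - Real.log n) / (12 * n ^ 2)| ≤ Real.log n * (0.1 * (1 / n)) := by
    rw [abs_div, abs_of_pos (by positivity : 0 < 12 * n ^ 2), abs_of_nonpos (by linarith),
      div_le_iff₀ (by positivity)]
    have : Real.log n * (0.1 * (1 / n)) * (12 * n ^ 2) = Real.log n * n * 1.2 := by
      field_simp
      norm_num
    rw [this]
    nlinarith
  have e3 : Real.log n / (2 * n) = Real.log n * (0.5 * (1 / n)) := by field_simp; norm_num
  have e4 : Real.log y ^ 2 / 2 - Real.log n ^ 2 / 2 ≤ Real.log y * (1 / n) := by nlinarith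
  have e5 : 0 ≤ Real.log y ^ 2 / 2 - Real.log n ^ 2 / 2 := by nlinarith
  have hn0 : 0 < 1 / n := by positivity
  have hs : √y * √y = y := Real.mul_self_sqrt (by linarith)
  have hs0 : 0 < √y := Real.sqrt_pos.2 (by linarith)
  have hs3 : 3 ≤ √y := Real.le_sqrt_of_sq_le (by linarith)
  have e6 : (Real.log y * 1.6 + 0.1) * (1 / n) ≤ 10 / √y := by
    rw [mul_one_div, div_le_div_iff₀ (by linarith) hs0]
    nlinarith
  have e7 : Real.log n * (1 / n) ≤ Real.log y * (1 / n) := mul_le_mul_of_nonneg_right hlny hn0.le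
  rw [e3] at h1
  norm_num at h1 e1 e2 e4 e6 e7 ⊢
  rw [abs_le] at h1 e2 ⊢
  constructor <;> nlinarith

theorem natCast_div_eq_floor (N a : ℕ) : N * N / a = ⌊(N : ℝ) ^ 2 / a⌋₊ := by
  rw [Nat.floor_div_natCast, sq, ← Nat.cast_mul, Nat.floor_natCast]

theorem log_sq_div {N a : ℕ} (hN : 0 < N) (ha : 0 < a) :
    Real.log ((N : ℝ) ^ 2 / a) = 2 * Real.log N - Real.log a := by
  rw [Real.log_div (by positivity) (by positivity), Real.log_pow]
  norm_num

theorem logPowDiv_nonneg (k n : ℕ) : 0 ≤ logPowDiv k n := by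
  rw [logPowDiv_apply]
  exact div_nonneg (pow_nonneg (Real.log_natCast_nonneg n) k) (Nat.cast_nonneg n)

/-- For `a ≤ N` one has `N²/a ≥ N`, so the approximation of the inner sum is uniformly within
`C/√N`. -/
theorem abs_sum_logPowDiv_mul_sub_le {j k N : ℕ} {φ : ℝ → ℝ} {C : ℝ} (hC : 0 ≤ C) (hN : 10 ≤ N)
    (h : ∀ y : ℝ, 10 ≤ y → |logHarmonic k ⌊y⌋₊ - φ y| ≤ C / √y) :
    |(∑ a ∈ Finset.Ioc 0 N, logPowDiv j a * logHarmonic k (N * N / a)) -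
      ∑ a ∈ Finset.Ioc 0 N, logPowDiv j a * φ ((N : ℝ) ^ 2 / a)| ≤ logHarmonic j N * (C / √N) := by
  rw [← Finset.sum_sub_distrib, logHarmonic, Finset.sum_mul]
  refine (Finset.abs_sum_le_sum_abs _ _).trans (Finset.sum_le_sum fun a ha => ?_)
  obtain ⟨ha1, ha2⟩ := Finset.mem_Ioc.1 ha
  have ha1' : (0 : ℝ) < a := by exact_mod_cast ha1
  have ha2' : (a : ℝ) ≤ N := by exact_mod_cast ha2
  have hN' : (10 : ℝ) ≤ N := by exact_mod_cast hN
  have hy : (N : ℝ) ≤ (N : ℝ) ^ 2 / a := by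
    rw [le_div_iff₀ ha1']
    nlinarith
  rw [← mul_sub, abs_mul, abs_of_nonneg (logPowDiv_nonneg j a), natCast_div_eq_floor]
  refine mul_le_mul_of_nonneg_left ((h _ (hN'.trans hy)).trans ?_) (logPowDiv_nonneg j a)
  exact div_le_div_of_nonneg_left hC (Real.sqrt_pos.2 (by linarith)) (Real.sqrt_le_sqrt hy)

theorem logHarmonic_le (j N : ℕ) :
    logHarmonic j N ≤ Real.log N ^ j * (1 + Real.log N) := by
  refine le_trans ?_ (mul_le_mul_of_nonneg_left (harmonic_le_one_add_log N)
    (pow_nonneg (Real.log_natCast_nonneg N) j))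
  rw [← logHarmonic_zero_eq, logHarmonic, logHarmonic, Finset.mul_sum]
  refine Finset.sum_le_sum fun a ha => ?_
  obtain ⟨ha1, ha2⟩ := Finset.mem_Ioc.1 ha
  rw [logPowDiv_apply, logPowDiv_apply, pow_zero, mul_one_div]
  refine div_le_div_of_nonneg_right (pow_le_pow_left₀ (Real.log_natCast_nonneg a) ?_ j)
    (Nat.cast_nonneg a)
  exact Real.log_le_log (by exact_mod_cast ha1) (by exact_mod_cast ha2)

theorem tendsto_log_pow_div_sqrt (j : ℕ) :
    Tendsto (fun N : ℕ => Real.log N ^ j / √N) atTop (𝓝 0) := by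
  have h := (isLittleO_log_rpow_rpow_atTop (j : ℝ) (s := 1 / 2) (by norm_num)).tendsto_div_nhds_zero
  refine (h.comp tendsto_natCast_atTop_atTop).congr fun N => ?_
  simp [Real.sqrt_eq_rpow]

theorem tendsto_log_pow_mul_of_abs_le {ε : ℕ → ℝ} {C : ℝ} (j : ℕ)
    (h : ∀ N : ℕ, 10 ≤ N → |ε N| ≤ C / √N) :
    Tendsto (fun N : ℕ => Real.log N ^ j * ε N) atTop (𝓝 0) := by
  have hC := (tendsto_log_pow_div_sqrt j).const_mul C
  rw [mul_zero] at hC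
  refine squeeze_zero_norm' ?_ hC
  filter_upwards [eventually_ge_atTop 10] with N hN
  rw [Real.norm_eq_abs, abs_mul, abs_of_nonneg (pow_nonneg (Real.log_natCast_nonneg N) j)]
  refine (mul_le_mul_of_nonneg_left (h N hN) (pow_nonneg (Real.log_natCast_nonneg N) j)).trans
    (le_of_eq ?_)
  ring

theorem tendsto_of_abs_le_logHarmonic_mul {δ : ℕ → ℝ} {C : ℝ} {j : ℕ} (hC : 0 ≤ C)
    (h : ∀ N : ℕ, 10 ≤ N → |δ N| ≤ logHarmonic j N * (C / √N)) : Tendsto δ atTop (𝓝 0) := by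
  have h1 := ((tendsto_log_pow_div_sqrt j).add (tendsto_log_pow_div_sqrt (j + 1))).const_mul C
  rw [add_zero, mul_zero] at h1
  refine squeeze_zero_norm' ?_ h1
  filter_upwards [eventually_ge_atTop 10] with N hN
  refine (h N hN).trans ((mul_le_mul_of_nonneg_right (logHarmonic_le j N)
    (by positivity)).trans (le_of_eq ?_))
  ring

section identification

local notation "γ" => Real.eulerMascheroniConstant

/-- Hyperbola method for `τ(n)/n = (1/n) * (1/n)` at `N²`, where the cutoff is exactly `N`. The
limit is the constant Laurent coefficient of `ζ(s)²` at `s = 1`. -/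
theorem tendsto_sum_tau_div :
    Tendsto (fun N : ℕ => ∑ n ∈ Finset.Ioc 0 (N * N), tau n * (1 / n)
      - (2 * Real.log N ^ 2 + 4 * γ * Real.log N)) atTop (𝓝 (γ ^ 2 - 2 * stieltjesConstant 1)) := by
  let e0 : ℕ → ℝ := fun N => logHarmonic 0 N - (Real.log N + γ)
  let e1 : ℕ → ℝ := fun N => logHarmonic 1 N - (Real.log N ^ 2 / 2 + stieltjesConstant 1)
  have h0 : ∀ N : ℕ, 10 ≤ N → |e0 N| ≤ 2 / √N := fun N hN => by
    have hN' : (10 : ℝ) ≤ N := by exact_mod_cast hN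
    simpa [e0] using abs_logHarmonic_zero_sub_le (y := (N : ℝ)) (by linarith)
  have h1 : ∀ N : ℕ, 10 ≤ N → |e1 N| ≤ 10 / √N := fun N hN => by
    have hN' : (10 : ℝ) ≤ N := by exact_mod_cast hN
    simpa [e1] using abs_logHarmonic_one_sub_le (y := (N : ℝ)) hN'
  let δ : ℕ → ℝ := fun N => (∑ a ∈ Finset.Ioc 0 N, logPowDiv 0 a * logHarmonic 0 (N * N / a)) -
      ∑ a ∈ Finset.Ioc 0 N, logPowDiv 0 a * (Real.log ((N : ℝ) ^ 2 / a) + γ)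
  have hδ : Tendsto δ atTop (𝓝 0) := tendsto_of_abs_le_logHarmonic_mul (C := 2) (j := 0)
    (by norm_num) fun N hN => abs_sum_logPowDiv_mul_sub_le (φ := fun y => Real.log y + γ)
      (by norm_num) hN fun y hy => abs_logHarmonic_zero_sub_le (by linarith)
  have t00 := tendsto_log_pow_mul_of_abs_le 0 h0
  have t01 := tendsto_log_pow_mul_of_abs_le 1 h0
  have t10 := tendsto_log_pow_mul_of_abs_le 0 h1
  have hlim := (((((t01.const_mul 2).sub (t10.const_mul 2)).sub (t00.mul t00)).add
    (hδ.const_mul 2)).add_const (γ ^ 2 - 2 * stieltjesConstant 1))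
  norm_num at hlim
  refine hlim.congr' ?_
  filter_upwards [eventually_ge_atTop 10] with N hN
  have hsum : ∑ a ∈ Finset.Ioc 0 N, logPowDiv 0 a * (Real.log ((N : ℝ) ^ 2 / a) + γ) =
      (2 * Real.log N + γ) * logHarmonic 0 N - logHarmonic 1 N := by
    simp only [logHarmonic]
    rw [Finset.mul_sum, ← Finset.sum_sub_distrib]
    refine Finset.sum_congr rfl fun a ha => ?_
    rw [log_sq_div (by omega) (Finset.mem_Ioc.1 ha).1, logPowDiv_apply, logPowDiv_apply]
    ring
  have hA : ∑ n ∈ Finset.Ioc 0 (N * N), tau n * (1 / (n : ℝ)) =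
      2 * (δ N + ((2 * Real.log N + γ) * logHarmonic 0 N - logHarmonic 1 N)) - logHarmonic 0 N ^ 2 := by
    rw [← hsum, Finset.sum_congr rfl fun n _ => (logPowDiv_zero_mul_zero n).symm,
      sum_Ioc_mul_hyperbola (logPowDiv 0) (logPowDiv 0) (M := N) le_rfl (by nlinarith)]
    simp only [δ, logHarmonic]
    ring
  rw [hA]
  simp only [e0, e1]
  ring

/-- The same for `τ(n) log n / n = 2 (1/n) * (log n / n)`. The limit is minus the coefficient of `s
- 1` in `ζ(s)²`. -/
theorem tendsto_sum_tau_log_div :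
    Tendsto (fun N : ℕ => ∑ n ∈ Finset.Ioc 0 (N * N), tau n * (Real.log n / n)
      - (8 / 3 * Real.log N ^ 3 + 4 * γ * Real.log N ^ 2)) atTop
      (𝓝 (2 * γ * stieltjesConstant 1 - stieltjesConstant 2)) := by
  let e0 : ℕ → ℝ := fun N => logHarmonic 0 N - (Real.log N + γ)
  let e1 : ℕ → ℝ := fun N => logHarmonic 1 N - (Real.log N ^ 2 / 2 + stieltjesConstant 1)
  have h0 : ∀ N : ℕ, 10 ≤ N → |e0 N| ≤ 2 / √N := fun N hN => by
    have hN' : (10 : ℝ) ≤ N := by exact_mod_cast hN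
    simpa [e0] using abs_logHarmonic_zero_sub_le (y := (N : ℝ)) (by linarith)
  have h1 : ∀ N : ℕ, 10 ≤ N → |e1 N| ≤ 10 / √N := fun N hN => by
    have hN' : (10 : ℝ) ≤ N := by exact_mod_cast hN
    simpa [e1] using abs_logHarmonic_one_sub_le (y := (N : ℝ)) hN'
  let δ : ℕ → ℝ := fun N => (∑ a ∈ Finset.Ioc 0 N, logPowDiv 1 a * logHarmonic 0 (N * N / a)) -
      ∑ a ∈ Finset.Ioc 0 N, logPowDiv 1 a * (Real.log ((N : ℝ) ^ 2 / a) + γ)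
  have hδ : Tendsto δ atTop (𝓝 0) := tendsto_of_abs_le_logHarmonic_mul (C := 2) (j := 1)
    (by norm_num) fun N hN => abs_sum_logPowDiv_mul_sub_le (φ := fun y => Real.log y + γ)
      (by norm_num) hN fun y hy => abs_logHarmonic_zero_sub_le (by linarith)
  let η : ℕ → ℝ := fun N => (∑ a ∈ Finset.Ioc 0 N, logPowDiv 0 a * logHarmonic 1 (N * N / a)) -
      ∑ a ∈ Finset.Ioc 0 N,
        logPowDiv 0 a * (Real.log ((N : ℝ) ^ 2 / a) ^ 2 / 2 + stieltjesConstant 1)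
  have hη : Tendsto η atTop (𝓝 0) := tendsto_of_abs_le_logHarmonic_mul (C := 10) (j := 0)
    (by norm_num) fun N hN => abs_sum_logPowDiv_mul_sub_le
      (φ := fun y => Real.log y ^ 2 / 2 + stieltjesConstant 1)
      (by norm_num) hN fun y hy => abs_logHarmonic_one_sub_le hy
  have t00 := tendsto_log_pow_mul_of_abs_le 0 h0
  have t02 := tendsto_log_pow_mul_of_abs_le 2 h0
  have t10 := tendsto_log_pow_mul_of_abs_le 0 h1
  have t11 := tendsto_log_pow_mul_of_abs_le 1 h1
  -- The sum of `log² m / m` enters with the constant coefficient `-1`, so for `γ₂` convergence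
  -- without a rate is enough.
  have hlim := (((((t02.const_mul 3).sub (t11.const_mul 2)).sub ((t00.mul t10).const_mul 2)).sub
    (stieltjes_two_bound le_rfl).1).add ((hδ.add hη).const_mul 2)).add_const
      (2 * γ * stieltjesConstant 1)
  norm_num at hlim
  rw [neg_add_eq_sub] at hlim
  refine hlim.congr' ?_
  filter_upwards [eventually_ge_atTop 10] with N hN
  have hsum : ∑ a ∈ Finset.Ioc 0 N, logPowDiv 1 a * (Real.log ((N : ℝ) ^ 2 / a) + γ) =
      (2 * Real.log N + γ) * logHarmonic 1 N - logHarmonic 2 N := by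
    simp only [logHarmonic]
    rw [Finset.mul_sum, ← Finset.sum_sub_distrib]
    refine Finset.sum_congr rfl fun a ha => ?_
    rw [log_sq_div (by omega) (Finset.mem_Ioc.1 ha).1, logPowDiv_apply, logPowDiv_apply]
    ring
  have hsum2 : ∑ a ∈ Finset.Ioc 0 N,
      logPowDiv 0 a * (Real.log ((N : ℝ) ^ 2 / a) ^ 2 / 2 + stieltjesConstant 1) =
      (2 * Real.log N ^ 2 + stieltjesConstant 1) * logHarmonic 0 N
        - 2 * Real.log N * logHarmonic 1 N + 1 / 2 * logHarmonic 2 N := by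
    simp only [logHarmonic]
    rw [Finset.mul_sum, Finset.mul_sum, Finset.mul_sum, ← Finset.sum_sub_distrib,
      ← Finset.sum_add_distrib]
    refine Finset.sum_congr rfl fun a ha => ?_
    rw [log_sq_div (by omega) (Finset.mem_Ioc.1 ha).1, logPowDiv_apply, logPowDiv_apply,
      logPowDiv_apply]
    ring
  have hA : ∑ n ∈ Finset.Ioc 0 (N * N), tau n * (Real.log n / n) =
      2 * (δ N + η N + ((2 * Real.log N + γ) * logHarmonic 1 N - logHarmonic 2 N)
        + ((2 * Real.log N ^ 2 + stieltjesConstant 1) * logHarmonic 0 N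
        - 2 * Real.log N * logHarmonic 1 N + 1 / 2 * logHarmonic 2 N)
        - logHarmonic 0 N * logHarmonic 1 N) := by
    rw [← hsum, ← hsum2, Finset.sum_congr rfl fun n _ => (two_mul_logPowDiv_zero_mul_one n).symm,
      ← Finset.mul_sum,
      sum_Ioc_mul_hyperbola (logPowDiv 0) (logPowDiv 1) (M := N) le_rfl (by nlinarith)]
    simp only [δ, η, logHarmonic]
    ring
  rw [hA, stieltjesSeq_eq]
  simp only [e0, e1]
  push_cast
  ring

theorem tendsto_divErr_sq_mul_log_pow (j : ℕ) :
    Tendsto (fun N : ℕ => Real.log N ^ j * (divErr ((N : ℝ) ^ 2) / (N : ℝ) ^ 2)) atTop (𝓝 0) := by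
  refine tendsto_log_pow_mul_of_abs_le (C := 2) j fun N hN => ?_
  have hN' : (10 : ℝ) ≤ N := by exact_mod_cast hN
  have h := abs_divErr_le (x := (N : ℝ) ^ 2) (one_le_pow₀ (by linarith))
  rw [Real.sqrt_sq (by linarith)] at h
  rw [abs_div, abs_of_pos (by positivity : (0 : ℝ) < (N : ℝ) ^ 2), div_le_div_iff₀ (by positivity)
    (Real.sqrt_pos.2 (by linarith))]
  have hs : √(N : ℝ) ≤ N := by
    rw [Real.sqrt_le_left (by linarith)]
    nlinarith
  have : |divErr ((N : ℝ) ^ 2)| ≤ 2 * N := by linarith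
  calc _ ≤ 2 * (N : ℝ) * N := mul_le_mul this hs (Real.sqrt_nonneg _) (by linarith)
    _ = _ := by ring

theorem floor_natCast_sq (N : ℕ) : ⌊(N : ℝ) ^ 2⌋₊ = N * N := by
  rw [sq, ← Nat.cast_mul, Nat.floor_natCast]

/-- Comparison of the exact formula `sum_tau_div` with the second evaluation `tendsto_sum_tau_div`.
Convergence along squares is all that is used. -/
theorem tendsto_divErrInt :
    Tendsto (fun N : ℕ => divErrInt ((N : ℝ) ^ 2)) atTop
      (𝓝 (γ ^ 2 - 2 * stieltjesConstant 1 - (2 * γ - 1))) := by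
  have h := (tendsto_sum_tau_div.sub_const (2 * γ - 1)).sub (tendsto_divErr_sq_mul_log_pow 0)
  rw [sub_zero] at h
  refine h.congr' ?_
  filter_upwards [eventually_ge_atTop 1] with N hN
  have hN' : (1 : ℝ) ≤ N := by exact_mod_cast hN
  have := sum_tau_div (b := (N : ℝ) ^ 2) (one_le_pow₀ hN')
  rw [floor_natCast_sq, Real.log_pow] at this
  rw [this]
  push_cast
  ring

theorem tendsto_divErrLogInt_sub :
    Tendsto (fun N : ℕ => divErrLogInt ((N : ℝ) ^ 2) - divErrInt ((N : ℝ) ^ 2)) atTop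
      (𝓝 (2 * γ * stieltjesConstant 1 - stieltjesConstant 2)) := by
  have h := tendsto_sum_tau_log_div.sub ((tendsto_divErr_sq_mul_log_pow 1).const_mul 2)
  rw [mul_zero, sub_zero] at h
  refine h.congr' ?_
  filter_upwards [eventually_ge_atTop 1] with N hN
  have hN' : (1 : ℝ) ≤ N := by exact_mod_cast hN
  have := sum_tau_log_div (b := (N : ℝ) ^ 2) (one_le_pow₀ hN')
  rw [floor_natCast_sq, Real.log_pow] at this
  rw [this]
  push_cast
  ring

/-- The bound for finite `T` is uniform, so `T = N²` may tend to infinity; at the limiting integrals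
`mainPoly` is the cubic with coefficients `C₁, …, C₄`. -/
theorem abs_sumDk_four_sub_le {y : ℝ} (hy : 1 ≤ y) :
    |sumDk 4 (y ^ 4) - y ^ 4 * (C₁ * (4 * Real.log y) ^ 3 + C₂ * (4 * Real.log y) ^ 2
        + C₃ * (4 * Real.log y) + C₄)| ≤
      4 * y ^ 3 * (4 * Real.log y + 4 * γ - 4)
        + y ^ 2 * (4 * Real.log y - 2 * γ + 24.5) + y + 19 / 16 := by
  have hmain : mainPoly γ (4 * Real.log y) (γ ^ 2 - 2 * stieltjesConstant 1 - (2 * γ - 1))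
      (2 * γ * stieltjesConstant 1 - stieltjesConstant 2) =
      C₁ * (4 * Real.log y) ^ 3 + C₂ * (4 * Real.log y) ^ 2 + C₃ * (4 * Real.log y) + C₄ := by
    simp only [mainPoly, C₁, C₂, C₃, C₄]
    ring
  rw [← hmain]
  have hcont : Continuous fun p : ℝ × ℝ => |sumDk 4 (y ^ 4) - y ^ 4 *
      mainPoly γ (4 * Real.log y) p.1 p.2| := by
    unfold mainPoly
    fun_prop
  have hlim := (hcont.tendsto _).comp (tendsto_divErrInt.prodMk_nhds tendsto_divErrLogInt_sub)
  refine le_of_tendsto hlim ?_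
  filter_upwards [eventually_ge_atTop ⌈y ^ 4⌉₊, eventually_ge_atTop 1] with N hN hN1
  refine abs_sumDk_four_sub_main_le hy ?_
  have h1 : y ^ 4 ≤ N := Nat.ceil_le.1 hN
  have h2 : (1 : ℝ) ≤ N := by exact_mod_cast hN1
  nlinarith

end identification

/-! ### Numerical values of logarithms and constants -/

theorem log_seven_bounds : 1.945910147 < Real.log 7 ∧ Real.log 7 < 1.945910150 := by
  have h : 4 * Real.log 7 = 5 * Real.log 2 + Real.log 3 + 2 * Real.log 5 + Real.log (1 + 1 / 2400) := by
    -- The near-coincidence `2401 = 2400 + 1` with `2400 = 2⁵ · 3 · 5²` gives `log 7` from the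
    -- logarithms of 2, 3 and 5.
    have e : (7 : ℝ) ^ 4 = 2 ^ 5 * 3 * 5 ^ 2 * (1 + 1 / 2400) := by norm_num
    have := congrArg Real.log e
    rw [Real.log_mul (by norm_num) (by norm_num), Real.log_mul (by norm_num) (by norm_num),
      Real.log_mul (by norm_num) (by norm_num), Real.log_pow, Real.log_pow, Real.log_pow] at this
    exact_mod_cast this
  have h1 := two_mul_div_two_add_le_log (z := 1 / 2400) (by norm_num)
  have h2 := log_one_add_le_mul_div (z := 1 / 2400) (by norm_num)
  norm_num at h1 h2
  constructor <;> linarith [Real.log_two_gt_d9, Real.log_two_lt_d9, Real.log_three_gt_d9,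
    Real.log_three_lt_d9, Real.log_five_gt_d9, Real.log_five_lt_d9]

theorem log_smooth {n a b c d : ℕ} (h : n = 2 ^ a * 3 ^ b * 5 ^ c * 7 ^ d) :
    Real.log n = a * Real.log 2 + b * Real.log 3 + c * Real.log 5 + d * Real.log 7 := by
  rw [h]
  push_cast
  rw [Real.log_mul (by positivity) (by positivity), Real.log_mul (by positivity) (by positivity),
    Real.log_mul (by positivity) (by positivity), Real.log_pow, Real.log_pow, Real.log_pow,
    Real.log_pow]

/-- `log n` is bounded below by `log s` for a nearby 7-smooth `s ≤ n` plus the midpoint bound for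
`log (n/s)`. -/
theorem le_log_of_smooth {n : ℕ} (s a b c d : ℕ) {lo : ℝ} (h : s = 2 ^ a * 3 ^ b * 5 ^ c * 7 ^ d)
    (hsn : s ≤ n) (hlo : lo ≤ a * 0.6931471803 + b * 1.0986122885 + c * 1.6094379123
      + d * 1.945910147 + 2 * ((n : ℝ) - s) / (n + s)) : lo ≤ Real.log n := by
  have hs0 : (0 : ℝ) < s := by
    rw [h]
    push_cast
    positivity
  have hsn' : (s : ℝ) ≤ n := by exact_mod_cast hsn
  have h1 := two_mul_div_two_add_le_log (z := ((n : ℝ) - s) / s) (div_nonneg (by linarith) hs0.le)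
  have e1 : 1 + ((n : ℝ) - s) / s = n / s := by field_simp; ring
  have e2 : 2 * (((n : ℝ) - s) / s) / (2 + ((n : ℝ) - s) / s) = 2 * ((n : ℝ) - s) / (n + s) := by
    have : (n : ℝ) + s ≠ 0 := by linarith
    rw [show 2 + ((n : ℝ) - s) / s = (n + s) / s by field_simp; ring]
    field_simp
  rw [e1, e2, Real.log_div (by linarith) hs0.ne', log_smooth h] at h1
  have ha := mul_le_mul_of_nonneg_left Real.log_two_gt_d9.le (Nat.cast_nonneg (α := ℝ) a)
  have hb := mul_le_mul_of_nonneg_left Real.log_three_gt_d9.le (Nat.cast_nonneg (α := ℝ) b)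
  have hc := mul_le_mul_of_nonneg_left Real.log_five_gt_d9.le (Nat.cast_nonneg (α := ℝ) c)
  have hd := mul_le_mul_of_nonneg_left log_seven_bounds.1.le (Nat.cast_nonneg (α := ℝ) d)
  linarith

theorem log_le_of_smooth {n : ℕ} (a b c d : ℕ) {hi : ℝ} (h : n = 2 ^ a * 3 ^ b * 5 ^ c * 7 ^ d)
    (hhi : a * 0.6931471808 + b * 1.0986122888 + c * 1.6094379126 + d * 1.945910150 ≤ hi) :
    Real.log n ≤ hi := by
  rw [log_smooth h]
  have ha := mul_le_mul_of_nonneg_left Real.log_two_lt_d9.le (Nat.cast_nonneg (α := ℝ) a)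
  have hb := mul_le_mul_of_nonneg_left Real.log_three_lt_d9.le (Nat.cast_nonneg (α := ℝ) b)
  have hc := mul_le_mul_of_nonneg_left Real.log_five_lt_d9.le (Nat.cast_nonneg (α := ℝ) c)
  have hd := mul_le_mul_of_nonneg_left log_seven_bounds.2.le (Nat.cast_nonneg (α := ℝ) d)
  linarith

theorem stieltjesSeq_ten (k : ℕ) :
    stieltjesSeq k 10 = (0 : ℝ) ^ k + Real.log 2 ^ k / 2 + Real.log 3 ^ k / 3
      + (2 * Real.log 2) ^ k / 4 + Real.log 5 ^ k / 5 + (Real.log 2 + Real.log 3) ^ k / 6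
      + Real.log 7 ^ k / 7 + (3 * Real.log 2) ^ k / 8 + (2 * Real.log 3) ^ k / 9
      + (Real.log 2 + Real.log 5) ^ k / 10 - (Real.log 2 + Real.log 5) ^ (k + 1) / (k + 1) := by
  have h4 : Real.log 4 = 2 * Real.log 2 := Real.log_four_eq
  have h6 : Real.log 6 = Real.log 2 + Real.log 3 := by
    rw [← Real.log_mul (by norm_num) (by norm_num)]; norm_num
  have h8 : Real.log 8 = 3 * Real.log 2 := by
    rw [show (8 : ℝ) = 2 ^ 3 by norm_num, Real.log_pow]; norm_num
  have h9 : Real.log 9 = 2 * Real.log 3 := by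
    rw [show (9 : ℝ) = 3 ^ 2 by norm_num, Real.log_pow]; norm_num
  simp only [stieltjesSeq, Finset.sum_Icc_succ_top (show 1 ≤ 10 by norm_num), Finset.sum_Icc_succ_top (show 1 ≤ 9 by norm_num),
    Finset.sum_Icc_succ_top (show 1 ≤ 8 by norm_num), Finset.sum_Icc_succ_top (show 1 ≤ 7 by norm_num),
    Finset.sum_Icc_succ_top (show 1 ≤ 6 by norm_num), Finset.sum_Icc_succ_top (show 1 ≤ 5 by norm_num),
    Finset.sum_Icc_succ_top (show 1 ≤ 4 by norm_num), Finset.sum_Icc_succ_top (show 1 ≤ 3 by norm_num),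
    Finset.sum_Icc_succ_top (show 1 ≤ 2 by norm_num), Finset.Icc_self, Finset.sum_singleton]
  push_cast
  rw [Real.log_one, h4, h6, h8, h9, Real.log_ten_eq, div_one]

theorem log_ten_cast : Real.log ((10 : ℕ) : ℝ) = Real.log 2 + Real.log 5 := by
  push_cast
  exact Real.log_ten_eq

theorem eulerMascheroniConstant_bounds :
    0.577210 ≤ Real.eulerMascheroniConstant ∧ Real.eulerMascheroniConstant ≤ 0.577221 := by
  have h := (stieltjes_zero_bound (N := 10) le_rfl).2
  rw [stieltjesConstant_zero, stieltjesSeq_ten] at h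
  norm_num at h
  rw [abs_le] at h
  constructor <;> linarith [Real.log_two_gt_d9, Real.log_two_lt_d9, Real.log_five_gt_d9,
    Real.log_five_lt_d9]

theorem sq_bounds {t lo hi : ℝ} (h0 : 0 ≤ lo) (h : lo < t ∧ t < hi) :
    lo ^ 2 ≤ t ^ 2 ∧ t ^ 2 ≤ hi ^ 2 :=
  ⟨pow_le_pow_left₀ h0 h.1.le 2, pow_le_pow_left₀ (by linarith) h.2.le 2⟩

theorem stieltjesConstant_one_bounds :
    -0.072822 ≤ stieltjesConstant 1 ∧ stieltjesConstant 1 ≤ -0.072810 := by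
  have h := (stieltjes_one_bound (N := 10) le_rfl).2
  rw [stieltjesSeq_ten, log_ten_cast] at h
  have h10 := sq_bounds (t := Real.log 2 + Real.log 5) (lo := 2.3025850926) (hi := 2.3025850934)
    (by norm_num) ⟨by linarith [Real.log_two_gt_d9, Real.log_five_gt_d9],
      by linarith [Real.log_two_lt_d9, Real.log_five_lt_d9]⟩
  norm_num at h h10
  rw [abs_le] at h
  constructor <;> linarith [Real.log_two_gt_d9, Real.log_two_lt_d9, Real.log_five_gt_d9,
    Real.log_five_lt_d9, Real.log_three_gt_d9, Real.log_three_lt_d9, log_seven_bounds.1,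
    log_seven_bounds.2]

theorem stieltjesConstant_two_bounds :
    -0.009696 ≤ stieltjesConstant 2 ∧ stieltjesConstant 2 ≤ -0.009684 := by
  have h := (stieltjes_two_bound (N := 10) le_rfl).2
  rw [stieltjesSeq_ten, log_ten_cast] at h
  have h2 := sq_bounds (by norm_num) ⟨Real.log_two_gt_d9, Real.log_two_lt_d9⟩
  have h3 := sq_bounds (by norm_num) ⟨Real.log_three_gt_d9, Real.log_three_lt_d9⟩
  have h5 := sq_bounds (by norm_num) ⟨Real.log_five_gt_d9, Real.log_five_lt_d9⟩
  have h7 := sq_bounds (by norm_num) log_seven_bounds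
  have h6 := sq_bounds (t := Real.log 2 + Real.log 3) (lo := 1.7917594688) (hi := 1.7917594696)
    (by norm_num) ⟨by linarith [Real.log_two_gt_d9, Real.log_three_gt_d9],
      by linarith [Real.log_two_lt_d9, Real.log_three_lt_d9]⟩
  have h10' : 2.3025850926 < Real.log 2 + Real.log 5 ∧ Real.log 2 + Real.log 5 < 2.3025850934 :=
    ⟨by linarith [Real.log_two_gt_d9, Real.log_five_gt_d9],
      by linarith [Real.log_two_lt_d9, Real.log_five_lt_d9]⟩
  have h10 := sq_bounds (by norm_num) h10'
  have h10c : 2.3025850926 ^ 3 ≤ (Real.log 2 + Real.log 5) ^ 3 ∧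
      (Real.log 2 + Real.log 5) ^ 3 ≤ 2.3025850934 ^ 3 :=
    ⟨pow_le_pow_left₀ (by norm_num) h10'.1.le 3, pow_le_pow_left₀ (by linarith) h10'.2.le 3⟩
  norm_num [mul_pow] at h h2 h3 h5 h6 h7 h10 h10c
  norm_num at h10'
  rw [abs_le] at h
  constructor <;> linarith

theorem constants_mem : C₂ ∈ Set.Ico (0.654 : ℝ) 0.655 ∧ C₃ ∈ Set.Ico (0.981 : ℝ) 0.982 ∧
    C₄ ∈ Set.Ico (0.272 : ℝ) 0.273 := by
  obtain ⟨g1, g2⟩ := eulerMascheroniConstant_bounds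
  obtain ⟨a1, a2⟩ := stieltjesConstant_one_bounds
  obtain ⟨b1, b2⟩ := stieltjesConstant_two_bounds
  unfold C₂ C₃ C₄
  generalize Real.eulerMascheroniConstant = g at *
  generalize stieltjesConstant 1 = a at *
  generalize stieltjesConstant 2 = b at *
  have s1 : 0.577210 ^ 2 ≤ g ^ 2 := pow_le_pow_left₀ (by norm_num) g1 2
  have s2 : g ^ 2 ≤ 0.577221 ^ 2 := pow_le_pow_left₀ (by linarith) g2 2
  have c1 : 0.577210 ^ 3 ≤ g ^ 3 := pow_le_pow_left₀ (by norm_num) g1 3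
  have c2 : g ^ 3 ≤ 0.577221 ^ 3 := pow_le_pow_left₀ (by linarith) g2 3
  have p1 : 0.577210 * 0.072810 ≤ g * (-a) := mul_le_mul g1 (by linarith) (by norm_num) (by linarith)
  have p2 : g * (-a) ≤ 0.577221 * 0.072822 := mul_le_mul g2 (by linarith) (by linarith) (by norm_num)
  norm_num at *
  refine ⟨⟨by linarith, by linarith⟩, ⟨by linarith, by linarith⟩, ⟨?_, ?_⟩⟩ <;> nlinarith

/-! ### Finite verification for small arguments -/

/-- `sumUpTo f n = ∑_{1 ≤ a ≤ n} f a`. -/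
def sumUpTo (f : ℕ → ℕ) : ℕ → ℕ
  | 0 => 0
  | n + 1 => sumUpTo f n + f (n + 1)

/-- The number of `(k + 1)`-tuples of positive integers with product at most `n`. -/
def tupleCount : ℕ → ℕ → ℕ
  | 0, n => n
  | k + 1, n => sumUpTo (fun a => tupleCount k (n / a)) n

theorem sumUpTo_eq (f : ℕ → ℕ) (n : ℕ) : sumUpTo f n = ∑ a ∈ Finset.Ioc 0 n, f a := by
  induction n with
  | zero => simp [sumUpTo]
  | succ n ih => rw [sumUpTo, ih, Finset.sum_Ioc_succ_top (Nat.zero_le n)]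

theorem tupleCount_eq (k n : ℕ) : tupleCount k n =
    ∑ m ∈ Finset.Ioc 0 n, (ArithmeticFunction.zeta ^ (k + 1) : ArithmeticFunction ℕ) m := by
  induction k generalizing n with
  | zero => rw [zero_add, pow_one, ArithmeticFunction.sum_Ioc_zeta, tupleCount]
  | succ k ih =>
    rw [pow_succ', ArithmeticFunction.sum_Ioc_mul_eq_sum_sum, tupleCount, sumUpTo_eq]
    refine Finset.sum_congr rfl fun a ha => ?_
    rw [ih, ArithmeticFunction.zeta_apply_ne (Finset.mem_Ioc.1 ha).1.ne', one_mul]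

theorem sumDk_eq_tupleCount (k : ℕ) (x : ℝ) : sumDk (k + 1) x = tupleCount k ⌊x⌋₊ := by
  rw [sumDk_eq_sum_zeta_pow, tupleCount_eq]

theorem tupleCount_mono (k : ℕ) : Monotone (tupleCount k) := fun m n h => by
  rw [tupleCount_eq, tupleCount_eq]
  exact Finset.sum_le_sum_of_subset (Finset.Ioc_subset_Ioc_right h)

/-- On `[m, k + 1)` the summatory function lies between its values `s` at `m` and `t` at `k`, and
the main term is increasing. Comparing opposite endpoints reduces the claim to two rational
inequalities. Here `lo` and `hi` enclose `log x`, and `r` is a lower bound for `m^{1/4}`. -/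
theorem abs_sumDk_four_sub_le_of_mem {x lo hi r : ℝ} {m k s t : ℕ} (hm : (m : ℝ) ≤ x)
    (hk : x < ((k + 1 : ℕ) : ℝ)) (hs : tupleCount 3 m = s) (ht : tupleCount 3 k = t) (hlo0 : 0 < lo)
    (hlo : lo ≤ Real.log m) (hhi : Real.log ((k + 1 : ℕ) : ℝ) ≤ hi) (hr : 0 ≤ r)
    (hrm : r ^ 4 ≤ m)
    (h1 : t ≤ m * (1 / 6 * lo ^ 3 + 0.654 * lo ^ 2 + 0.981 * lo + 0.272) + 4.48 * r ^ 3 * lo)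
    (h2 : (k + 1) * (1 / 6 * hi ^ 3 + 0.655 * hi ^ 2 + 0.982 * hi + 0.273) ≤
      s + 4.48 * r ^ 3 * lo) :
    |sumDk 4 x - (C₁ * x * Real.log x ^ 3 + C₂ * x * Real.log x ^ 2
      + C₃ * x * Real.log x + C₄ * x)| ≤ 4.48 * x ^ (3 / 4 : ℝ) * Real.log x := by
  have hm0 : (0 : ℝ) < m := by
    rcases Nat.eq_zero_or_pos m with h | h
    · rw [h, Nat.cast_zero, Real.log_zero] at hlo
      linarith
    · exact_mod_cast h
  have hx0 : 0 < x := by linarith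
  have hlx := hlo.trans (Real.log_le_log hm0 hm)
  have hxh := (Real.log_le_log hx0 hk.le).trans hhi
  have hS : sumDk 4 x = tupleCount 3 ⌊x⌋₊ := sumDk_eq_tupleCount 3 x
  have hSt : sumDk 4 x ≤ t := by
    rw [hS, ← ht]
    exact_mod_cast tupleCount_mono 3 (Nat.lt_succ_iff.1 ((Nat.floor_lt hx0.le).2 hk))
  have hSs : s ≤ sumDk 4 x := by
    rw [hS, ← hs]
    exact_mod_cast tupleCount_mono 3 (Nat.le_floor hm)
  have hpow : r ^ 3 ≤ x ^ (3 / 4 : ℝ) := by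
    have h4 : r ≤ x ^ (1 / 4 : ℝ) := by
      have : (r ^ 4) ^ (1 / 4 : ℝ) ≤ x ^ (1 / 4 : ℝ) :=
        Real.rpow_le_rpow (by positivity) (hrm.trans hm) (by norm_num)
      rwa [← Real.rpow_natCast r 4, ← Real.rpow_mul hr, show ((4 : ℕ) : ℝ) * (1 / 4) = 1 by norm_num,
        Real.rpow_one] at this
    have := pow_le_pow_left₀ hr h4 3
    rwa [← Real.rpow_natCast (x ^ (1 / 4 : ℝ)) 3, ← Real.rpow_mul hx0.le,
      show (1 / 4 : ℝ) * ((3 : ℕ) : ℝ) = 3 / 4 by norm_num] at this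
  have hR : 4.48 * r ^ 3 * lo ≤ 4.48 * x ^ (3 / 4 : ℝ) * Real.log x :=
    mul_le_mul (by linarith) hlx hlo0.le (by positivity)
  obtain ⟨⟨c2, c2'⟩, ⟨c3, c3'⟩, ⟨c4, c4'⟩⟩ := constants_mem
  set L := Real.log x
  have hL0 : 0 < L := by linarith
  have q2 := pow_le_pow_left₀ hlo0.le hlx 2
  have q3 := pow_le_pow_left₀ hlo0.le hlx 3
  have r2 := pow_le_pow_left₀ hL0.le hxh 2
  have r3 := pow_le_pow_left₀ hL0.le hxh 3
  have hlow : 1 / 6 * lo ^ 3 + 0.654 * lo ^ 2 + 0.981 * lo + 0.272 ≤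
      C₁ * L ^ 3 + C₂ * L ^ 2 + C₃ * L + C₄ := by
    unfold C₁
    have t2 := mul_le_mul c2 q2 (by positivity) (by linarith)
    have t3 := mul_le_mul c3 hlx hlo0.le (by linarith)
    linarith
  have hupp : C₁ * L ^ 3 + C₂ * L ^ 2 + C₃ * L + C₄ ≤
      1 / 6 * hi ^ 3 + 0.655 * hi ^ 2 + 0.982 * hi + 0.273 := by
    unfold C₁
    have t2 := mul_le_mul c2'.le r2 (by positivity) (by norm_num)
    have t3 := mul_le_mul c3'.le hxh hL0.le (by norm_num)
    linarith
  have hlow0 : 0 < 1 / 6 * lo ^ 3 + 0.654 * lo ^ 2 + 0.981 * lo + 0.272 := by positivity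
  have m1 := mul_le_mul hm hlow hlow0.le hx0.le
  have m2 := mul_le_mul hk.le hupp (by linarith) (by positivity)
  push_cast at m2
  rw [show C₁ * x * L ^ 3 + C₂ * x * L ^ 2 + C₃ * x * L + C₄ * x =
    x * (C₁ * L ^ 3 + C₂ * L ^ 2 + C₃ * L + C₄) by ring]
  exact abs_le.2 ⟨by linarith, by linarith⟩

theorem sumDk_four_le_of_mem {x lo : ℝ} {m k t : ℕ} (hm : (m : ℝ) ≤ x)
    (hk : x < ((k + 1 : ℕ) : ℝ)) (ht : tupleCount 3 k = t) (hlo0 : 0 < lo)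
    (hlo : lo ≤ Real.log m) (h1 : t ≤ 1 / 3 * m * lo ^ 3) :
    sumDk 4 x ≤ 1 / 3 * x * Real.log x ^ 3 := by
  have hm0 : (0 : ℝ) < m := by
    rcases Nat.eq_zero_or_pos m with h | h
    · rw [h, Nat.cast_zero, Real.log_zero] at hlo
      linarith
    · exact_mod_cast h
  have hx0 : 0 < x := by linarith
  have hSt : sumDk 4 x ≤ t := by
    rw [show sumDk 4 x = tupleCount 3 ⌊x⌋₊ from sumDk_eq_tupleCount 3 x, ← ht]
    exact_mod_cast tupleCount_mono 3 (Nat.lt_succ_iff.1 ((Nat.floor_lt hx0.le).2 hk))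
  refine (hSt.trans h1).trans (mul_le_mul (by linarith) ?_ (by positivity) (by positivity))
  exact pow_le_pow_left₀ hlo0.le (hlo.trans (Real.log_le_log hm0 hm)) 3

/-- The breakpoints are 7-smooth, so their logarithms are known on both sides, and dense enough for
the slack in the error term to cover each interval. -/
theorem abs_sumDk_four_sub_le_of_lt {x : ℝ} (hx : 2 ≤ x) (hx' : x < 112) :
    |sumDk 4 x - (C₁ * x * Real.log x ^ 3 + C₂ * x * Real.log x ^ 2
      + C₃ * x * Real.log x + C₄ * x)| ≤ 4.48 * x ^ (3 / 4 : ℝ) * Real.log x := by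
  rcases lt_or_ge x 3 with h | hx
  · exact abs_sumDk_four_sub_le_of_mem (m := 2) (k := 2) (r := 1.189) (by exact_mod_cast hx) (by norm_num; exact h)
      (by decide +kernel : tupleCount 3 2 = 5) (by decide +kernel : tupleCount 3 2 = 5)
      (by norm_num) (le_log_of_smooth (lo := 0.693) 2 1 0 0 0 (by norm_num) le_rfl (by norm_num))
      (log_le_of_smooth (hi := 1.099) 0 1 0 0 (by norm_num) (by norm_num))
      (by norm_num) (by norm_num) (by norm_num) (by norm_num)
  rcases lt_or_ge x 4 with h | hx
  · exact abs_sumDk_four_sub_le_of_mem (m := 3) (k := 3) (r := 1.316) (by exact_mod_cast hx) (by norm_num; exact h)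
      (by decide +kernel : tupleCount 3 3 = 9) (by decide +kernel : tupleCount 3 3 = 9)
      (by norm_num) (le_log_of_smooth (lo := 1.098) 3 0 1 0 0 (by norm_num) le_rfl (by norm_num))
      (log_le_of_smooth (hi := 1.387) 2 0 0 0 (by norm_num) (by norm_num))
      (by norm_num) (by norm_num) (by norm_num) (by norm_num)
  rcases lt_or_ge x 6 with h | hx
  · exact abs_sumDk_four_sub_le_of_mem (m := 4) (k := 5) (r := 1.414) (by exact_mod_cast hx) (by norm_num; exact h)
      (by decide +kernel : tupleCount 3 4 = 19) (by decide +kernel : tupleCount 3 5 = 23)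
      (by norm_num) (le_log_of_smooth (lo := 1.386) 4 2 0 0 0 (by norm_num) le_rfl (by norm_num))
      (log_le_of_smooth (hi := 1.792) 1 1 0 0 (by norm_num) (by norm_num))
      (by norm_num) (by norm_num) (by norm_num) (by norm_num)
  rcases lt_or_ge x 8 with h | hx
  · exact abs_sumDk_four_sub_le_of_mem (m := 6) (k := 7) (r := 1.565) (by exact_mod_cast hx) (by norm_num; exact h)
      (by decide +kernel : tupleCount 3 6 = 39) (by decide +kernel : tupleCount 3 7 = 43)
      (by norm_num) (le_log_of_smooth (lo := 1.791) 6 1 1 0 0 (by norm_num) le_rfl (by norm_num))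
      (log_le_of_smooth (hi := 2.08) 3 0 0 0 (by norm_num) (by norm_num))
      (by norm_num) (by norm_num) (by norm_num) (by norm_num)
  rcases lt_or_ge x 10 with h | hx
  · exact abs_sumDk_four_sub_le_of_mem (m := 8) (k := 9) (r := 1.681) (by exact_mod_cast hx) (by norm_num; exact h)
      (by decide +kernel : tupleCount 3 8 = 63) (by decide +kernel : tupleCount 3 9 = 73)
      (by norm_num) (le_log_of_smooth (lo := 2.079) 8 3 0 0 0 (by norm_num) le_rfl (by norm_num))
      (log_le_of_smooth (hi := 2.303) 1 0 1 0 (by norm_num) (by norm_num))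
      (by norm_num) (by norm_num) (by norm_num) (by norm_num)
  rcases lt_or_ge x 14 with h | hx
  · exact abs_sumDk_four_sub_le_of_mem (m := 10) (k := 13) (r := 1.778) (by exact_mod_cast hx) (by norm_num; exact h)
      (by decide +kernel : tupleCount 3 10 = 89) (by decide +kernel : tupleCount 3 13 = 137)
      (by norm_num) (le_log_of_smooth (lo := 2.302) 10 1 0 1 0 (by norm_num) le_rfl (by norm_num))
      (log_le_of_smooth (hi := 2.64) 1 0 0 1 (by norm_num) (by norm_num))
      (by norm_num) (by norm_num) (by norm_num) (by norm_num)
  rcases lt_or_ge x 18 with h | hx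
  · exact abs_sumDk_four_sub_le_of_mem (m := 14) (k := 17) (r := 1.934) (by exact_mod_cast hx) (by norm_num; exact h)
      (by decide +kernel : tupleCount 3 14 = 153) (by decide +kernel : tupleCount 3 17 = 208)
      (by norm_num) (le_log_of_smooth (lo := 2.639) 14 1 0 0 1 (by norm_num) le_rfl (by norm_num))
      (log_le_of_smooth (hi := 2.891) 1 2 0 0 (by norm_num) (by norm_num))
      (by norm_num) (by norm_num) (by norm_num) (by norm_num)
  rcases lt_or_ge x 21 with h | hx
  · exact abs_sumDk_four_sub_le_of_mem (m := 18) (k := 20) (r := 2.059) (by exact_mod_cast hx) (by norm_num; exact h)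
      (by decide +kernel : tupleCount 3 18 = 248) (by decide +kernel : tupleCount 3 20 = 292)
      (by norm_num) (le_log_of_smooth (lo := 2.89) 18 1 2 0 0 (by norm_num) le_rfl (by norm_num))
      (log_le_of_smooth (hi := 3.045) 0 1 0 1 (by norm_num) (by norm_num))
      (by norm_num) (by norm_num) (by norm_num) (by norm_num)
  rcases lt_or_ge x 25 with h | hx
  · exact abs_sumDk_four_sub_le_of_mem (m := 21) (k := 24) (r := 2.14) (by exact_mod_cast hx) (by norm_num; exact h)
      (by decide +kernel : tupleCount 3 21 = 308) (by decide +kernel : tupleCount 3 24 = 408)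
      (by norm_num) (le_log_of_smooth (lo := 3.044) 21 0 1 0 1 (by norm_num) le_rfl (by norm_num))
      (log_le_of_smooth (hi := 3.219) 0 0 2 0 (by norm_num) (by norm_num))
      (by norm_num) (by norm_num) (by norm_num) (by norm_num)
  rcases lt_or_ge x 30 with h | hx
  · exact abs_sumDk_four_sub_le_of_mem (m := 25) (k := 29) (r := 2.236) (by exact_mod_cast hx) (by norm_num; exact h)
      (by decide +kernel : tupleCount 3 25 = 418) (by decide +kernel : tupleCount 3 29 = 498)
      (by norm_num) (le_log_of_smooth (lo := 3.218) 25 0 0 2 0 (by norm_num) le_rfl (by norm_num))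
      (log_le_of_smooth (hi := 3.402) 1 1 1 0 (by norm_num) (by norm_num))
      (by norm_num) (by norm_num) (by norm_num) (by norm_num)
  rcases lt_or_ge x 36 with h | hx
  · exact abs_sumDk_four_sub_le_of_mem (m := 30) (k := 35) (r := 2.34) (by exact_mod_cast hx) (by norm_num; exact h)
      (by decide +kernel : tupleCount 3 30 = 562) (by decide +kernel : tupleCount 3 35 = 670)
      (by norm_num) (le_log_of_smooth (lo := 3.401) 30 1 1 1 0 (by norm_num) le_rfl (by norm_num))
      (log_le_of_smooth (hi := 3.584) 2 2 0 0 (by norm_num) (by norm_num))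
      (by norm_num) (by norm_num) (by norm_num) (by norm_num)
  rcases lt_or_ge x 42 with h | hx
  · exact abs_sumDk_four_sub_le_of_mem (m := 36) (k := 41) (r := 2.449) (by exact_mod_cast hx) (by norm_num; exact h)
      (by decide +kernel : tupleCount 3 36 = 770) (by decide +kernel : tupleCount 3 41 = 890)
      (by norm_num) (le_log_of_smooth (lo := 3.583) 36 2 2 0 0 (by norm_num) le_rfl (by norm_num))
      (log_le_of_smooth (hi := 3.738) 1 1 0 1 (by norm_num) (by norm_num))
      (by norm_num) (by norm_num) (by norm_num) (by norm_num)
  rcases lt_or_ge x 48 with h | hx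
  · exact abs_sumDk_four_sub_le_of_mem (m := 42) (k := 47) (r := 2.545) (by exact_mod_cast hx) (by norm_num; exact h)
      (by decide +kernel : tupleCount 3 42 = 954) (by decide +kernel : tupleCount 3 47 = 1058)
      (by norm_num) (le_log_of_smooth (lo := 3.737) 42 1 1 0 1 (by norm_num) le_rfl (by norm_num))
      (log_le_of_smooth (hi := 3.872) 4 1 0 0 (by norm_num) (by norm_num))
      (by norm_num) (by norm_num) (by norm_num) (by norm_num)
  rcases lt_or_ge x 56 with h | hx
  · exact abs_sumDk_four_sub_le_of_mem (m := 48) (k := 55) (r := 2.632) (by exact_mod_cast hx) (by norm_num; exact h)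
      (by decide +kernel : tupleCount 3 48 = 1198) (by decide +kernel : tupleCount 3 55 = 1404)
      (by norm_num) (le_log_of_smooth (lo := 3.871) 48 4 1 0 0 (by norm_num) le_rfl (by norm_num))
      (log_le_of_smooth (hi := 4.026) 3 0 0 1 (by norm_num) (by norm_num))
      (by norm_num) (by norm_num) (by norm_num) (by norm_num)
  rcases lt_or_ge x 64 with h | hx
  · exact abs_sumDk_four_sub_le_of_mem (m := 56) (k := 63) (r := 2.735) (by exact_mod_cast hx) (by norm_num; exact h)
      (by decide +kernel : tupleCount 3 56 = 1484) (by decide +kernel : tupleCount 3 63 = 1740)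
      (by norm_num) (le_log_of_smooth (lo := 4.025) 56 3 0 0 1 (by norm_num) le_rfl (by norm_num))
      (log_le_of_smooth (hi := 4.159) 6 0 0 0 (by norm_num) (by norm_num))
      (by norm_num) (by norm_num) (by norm_num) (by norm_num)
  rcases lt_or_ge x 72 with h | hx
  · exact abs_sumDk_four_sub_le_of_mem (m := 64) (k := 71) (r := 2.828) (by exact_mod_cast hx) (by norm_num; exact h)
      (by decide +kernel : tupleCount 3 64 = 1824) (by decide +kernel : tupleCount 3 71 = 2032)
      (by norm_num) (le_log_of_smooth (lo := 4.158) 64 6 0 0 0 (by norm_num) le_rfl (by norm_num))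
      (log_le_of_smooth (hi := 4.277) 3 2 0 0 (by norm_num) (by norm_num))
      (by norm_num) (by norm_num) (by norm_num) (by norm_num)
  rcases lt_or_ge x 81 with h | hx
  · exact abs_sumDk_four_sub_le_of_mem (m := 72) (k := 80) (r := 2.912) (by exact_mod_cast hx) (by norm_num; exact h)
      (by decide +kernel : tupleCount 3 72 = 2232) (by decide +kernel : tupleCount 3 80 = 2556)
      (by norm_num) (le_log_of_smooth (lo := 4.276) 72 3 2 0 0 (by norm_num) le_rfl (by norm_num))
      (log_le_of_smooth (hi := 4.395) 0 4 0 0 (by norm_num) (by norm_num))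
      (by norm_num) (by norm_num) (by norm_num) (by norm_num)
  rcases lt_or_ge x 90 with h | hx
  · exact abs_sumDk_four_sub_le_of_mem (m := 81) (k := 89) (r := 3.0) (by exact_mod_cast hx) (by norm_num; exact h)
      (by decide +kernel : tupleCount 3 81 = 2591) (by decide +kernel : tupleCount 3 89 = 2903)
      (by norm_num) (le_log_of_smooth (lo := 4.394) 81 0 4 0 0 (by norm_num) le_rfl (by norm_num))
      (log_le_of_smooth (hi := 4.5) 1 2 1 0 (by norm_num) (by norm_num))
      (by norm_num) (by norm_num) (by norm_num) (by norm_num)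
  rcases lt_or_ge x 100 with h | hx
  · exact abs_sumDk_four_sub_le_of_mem (m := 90) (k := 99) (r := 3.08) (by exact_mod_cast hx) (by norm_num; exact h)
      (by decide +kernel : tupleCount 3 90 = 3063) (by decide +kernel : tupleCount 3 99 = 3475)
      (by norm_num) (le_log_of_smooth (lo := 4.499) 90 1 2 1 0 (by norm_num) le_rfl (by norm_num))
      (log_le_of_smooth (hi := 4.606) 2 0 2 0 (by norm_num) (by norm_num))
      (by norm_num) (by norm_num) (by norm_num) (by norm_num)
  exact abs_sumDk_four_sub_le_of_mem (m := 100) (k := 111) (r := 3.162) (by exact_mod_cast hx) (by norm_num; exact hx')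
      (by decide +kernel : tupleCount 3 100 = 3575) (by decide +kernel : tupleCount 3 111 = 4095)
      (by norm_num) (le_log_of_smooth (lo := 4.605) 100 2 0 2 0 (by norm_num) le_rfl (by norm_num))
      (log_le_of_smooth (hi := 4.719) 4 0 0 1 (by norm_num) (by norm_num))
      (by norm_num) (by norm_num) (by norm_num) (by norm_num)

/-- The start 193 matters: at `x = 192` the sum is 9329, while the bound is about 9301. -/
theorem sumDk_four_le_of_lt {x : ℝ} (hx : 193 ≤ x) (hx' : x < 408) :
    sumDk 4 x ≤ 1 / 3 * x * Real.log x ^ 3 := by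
  rcases lt_or_ge x 195 with h | hx
  · exact sumDk_four_le_of_mem (m := 193) (k := 194) (by exact_mod_cast hx) (by norm_num; exact h)
      (by decide +kernel : tupleCount 3 194 = 9349) (by norm_num)
      (le_log_of_smooth (lo := 5.2626) 192 6 1 0 0 (by norm_num) (by norm_num) (by norm_num)) (by norm_num)
  rcases lt_or_ge x 198 with h | hx
  · exact sumDk_four_le_of_mem (m := 195) (k := 197) (by exact_mod_cast hx) (by norm_num; exact h)
      (by decide +kernel : tupleCount 3 197 = 9517) (by norm_num)
      (le_log_of_smooth (lo := 5.2729) 192 6 1 0 0 (by norm_num) (by norm_num) (by norm_num)) (by norm_num)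
  rcases lt_or_ge x 200 with h | hx
  · exact sumDk_four_le_of_mem (m := 198) (k := 199) (by exact_mod_cast hx) (by norm_num; exact h)
      (by decide +kernel : tupleCount 3 199 = 9681) (by norm_num)
      (le_log_of_smooth (lo := 5.2882) 196 2 0 0 2 (by norm_num) (by norm_num) (by norm_num)) (by norm_num)
  rcases lt_or_ge x 203 with h | hx
  · exact sumDk_four_le_of_mem (m := 200) (k := 202) (by exact_mod_cast hx) (by norm_num; exact h)
      (by decide +kernel : tupleCount 3 202 = 9913) (by norm_num)
      (le_log_of_smooth (lo := 5.2983) 200 3 0 2 0 (by norm_num) (by norm_num) (by norm_num)) (by norm_num)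
  rcases lt_or_ge x 207 with h | hx
  · exact sumDk_four_le_of_mem (m := 203) (k := 206) (by exact_mod_cast hx) (by norm_num; exact h)
      (by decide +kernel : tupleCount 3 206 = 10121) (by norm_num)
      (le_log_of_smooth (lo := 5.3132) 200 3 0 2 0 (by norm_num) (by norm_num) (by norm_num)) (by norm_num)
  rcases lt_or_ge x 210 with h | hx
  · exact sumDk_four_le_of_mem (m := 207) (k := 209) (by exact_mod_cast hx) (by norm_num; exact h)
      (by decide +kernel : tupleCount 3 209 = 10317) (by norm_num)
      (le_log_of_smooth (lo := 5.3327) 200 3 0 2 0 (by norm_num) (by norm_num) (by norm_num)) (by norm_num)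
  rcases lt_or_ge x 216 with h | hx
  · exact sumDk_four_le_of_mem (m := 210) (k := 215) (by exact_mod_cast hx) (by norm_num; exact h)
      (by decide +kernel : tupleCount 3 215 = 10665) (by norm_num)
      (le_log_of_smooth (lo := 5.3471) 210 1 1 1 1 (by norm_num) (by norm_num) (by norm_num)) (by norm_num)
  rcases lt_or_ge x 220 with h | hx
  · exact sumDk_four_le_of_mem (m := 216) (k := 219) (by exact_mod_cast hx) (by norm_num; exact h)
      (by decide +kernel : tupleCount 3 219 = 11113) (by norm_num)
      (le_log_of_smooth (lo := 5.3752) 216 3 3 0 0 (by norm_num) (by norm_num) (by norm_num)) (by norm_num)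
  rcases lt_or_ge x 224 with h | hx
  · exact sumDk_four_le_of_mem (m := 220) (k := 223) (by exact_mod_cast hx) (by norm_num; exact h)
      (by decide +kernel : tupleCount 3 223 = 11357) (by norm_num)
      (le_log_of_smooth (lo := 5.3936) 216 3 3 0 0 (by norm_num) (by norm_num) (by norm_num)) (by norm_num)
  rcases lt_or_ge x 228 with h | hx
  · exact sumDk_four_le_of_mem (m := 224) (k := 227) (by exact_mod_cast hx) (by norm_num; exact h)
      (by decide +kernel : tupleCount 3 227 = 11701) (by norm_num)
      (le_log_of_smooth (lo := 5.4116) 224 5 0 0 1 (by norm_num) (by norm_num) (by norm_num)) (by norm_num)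
  rcases lt_or_ge x 234 with h | hx
  · exact sumDk_four_le_of_mem (m := 228) (k := 233) (by exact_mod_cast hx) (by norm_num; exact h)
      (by decide +kernel : tupleCount 3 233 = 12077) (by norm_num)
      (le_log_of_smooth (lo := 5.4293) 225 0 2 2 0 (by norm_num) (by norm_num) (by norm_num)) (by norm_num)
  rcases lt_or_ge x 240 with h | hx
  · exact sumDk_four_le_of_mem (m := 234) (k := 239) (by exact_mod_cast hx) (by norm_num; exact h)
      (by decide +kernel : tupleCount 3 239 = 12377) (by norm_num)
      (le_log_of_smooth (lo := 5.4553) 225 0 2 2 0 (by norm_num) (by norm_num) (by norm_num)) (by norm_num)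
  rcases lt_or_ge x 246 with h | hx
  · exact sumDk_four_le_of_mem (m := 240) (k := 245) (by exact_mod_cast hx) (by norm_num; exact h)
      (by decide +kernel : tupleCount 3 245 = 13117) (by norm_num)
      (le_log_of_smooth (lo := 5.4806) 240 4 1 1 0 (by norm_num) (by norm_num) (by norm_num)) (by norm_num)
  rcases lt_or_ge x 252 with h | hx
  · exact sumDk_four_le_of_mem (m := 246) (k := 251) (by exact_mod_cast hx) (by norm_num; exact h)
      (by decide +kernel : tupleCount 3 251 = 13377) (by norm_num)
      (le_log_of_smooth (lo := 5.5053) 245 0 0 1 2 (by norm_num) (by norm_num) (by norm_num)) (by norm_num)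
  rcases lt_or_ge x 260 with h | hx
  · exact sumDk_four_le_of_mem (m := 252) (k := 259) (by exact_mod_cast hx) (by norm_num; exact h)
      (by decide +kernel : tupleCount 3 259 = 14122) (by norm_num)
      (le_log_of_smooth (lo := 5.5294) 252 2 2 0 1 (by norm_num) (by norm_num) (by norm_num)) (by norm_num)
  rcases lt_or_ge x 270 with h | hx
  · exact sumDk_four_le_of_mem (m := 260) (k := 269) (by exact_mod_cast hx) (by norm_num; exact h)
      (by decide +kernel : tupleCount 3 269 = 14802) (by norm_num)
      (le_log_of_smooth (lo := 5.5606) 256 8 0 0 0 (by norm_num) (by norm_num) (by norm_num)) (by norm_num)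
  rcases lt_or_ge x 280 with h | hx
  · exact sumDk_four_le_of_mem (m := 270) (k := 279) (by exact_mod_cast hx) (by norm_num; exact h)
      (by decide +kernel : tupleCount 3 279 = 15606) (by norm_num)
      (le_log_of_smooth (lo := 5.5984) 270 1 3 1 0 (by norm_num) (by norm_num) (by norm_num)) (by norm_num)
  rcases lt_or_ge x 288 with h | hx
  · exact sumDk_four_le_of_mem (m := 280) (k := 287) (by exact_mod_cast hx) (by norm_num; exact h)
      (by decide +kernel : tupleCount 3 287 = 16182) (by norm_num)
      (le_log_of_smooth (lo := 5.6347) 280 3 0 1 1 (by norm_num) (by norm_num) (by norm_num)) (by norm_num)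
  rcases lt_or_ge x 300 with h | hx
  · exact sumDk_four_le_of_mem (m := 288) (k := 299) (by exact_mod_cast hx) (by norm_num; exact h)
      (by decide +kernel : tupleCount 3 299 = 17244) (by norm_num)
      (le_log_of_smooth (lo := 5.6629) 288 5 2 0 0 (by norm_num) (by norm_num) (by norm_num)) (by norm_num)
  rcases lt_or_ge x 312 with h | hx
  · exact sumDk_four_le_of_mem (m := 300) (k := 311) (by exact_mod_cast hx) (by norm_num; exact h)
      (by decide +kernel : tupleCount 3 311 = 18256) (by norm_num)
      (le_log_of_smooth (lo := 5.7037) 300 2 1 2 0 (by norm_num) (by norm_num) (by norm_num)) (by norm_num)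
  rcases lt_or_ge x 325 with h | hx
  · exact sumDk_four_le_of_mem (m := 312) (k := 324) (by exact_mod_cast hx) (by norm_num; exact h)
      (by decide +kernel : tupleCount 3 324 = 19662) (by norm_num)
      (le_log_of_smooth (lo := 5.7429) 300 2 1 2 0 (by norm_num) (by norm_num) (by norm_num)) (by norm_num)
  rcases lt_or_ge x 340 with h | hx
  · exact sumDk_four_le_of_mem (m := 325) (k := 339) (by exact_mod_cast hx) (by norm_num; exact h)
      (by decide +kernel : tupleCount 3 339 = 20822) (by norm_num)
      (le_log_of_smooth (lo := 5.7838) 324 2 4 0 0 (by norm_num) (by norm_num) (by norm_num)) (by norm_num)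
  rcases lt_or_ge x 360 with h | hx
  · exact sumDk_four_le_of_mem (m := 340) (k := 359) (by exact_mod_cast hx) (by norm_num; exact h)
      (by decide +kernel : tupleCount 3 359 = 22178) (by norm_num)
      (le_log_of_smooth (lo := 5.8289) 336 4 1 0 1 (by norm_num) (by norm_num) (by norm_num)) (by norm_num)
  rcases lt_or_ge x 383 with h | hx
  · exact sumDk_four_le_of_mem (m := 360) (k := 382) (by exact_mod_cast hx) (by norm_num; exact h)
      (by decide +kernel : tupleCount 3 382 = 24468) (by norm_num)
      (le_log_of_smooth (lo := 5.8861) 360 3 2 1 0 (by norm_num) (by norm_num) (by norm_num)) (by norm_num)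
  exact sumDk_four_le_of_mem (m := 383) (k := 407) (by exact_mod_cast hx) (by norm_num; exact hx')
      (by decide +kernel : tupleCount 3 407 = 26814) (by norm_num)
      (le_log_of_smooth (lo := 5.948) 378 1 3 0 1 (by norm_num) (by norm_num) (by norm_num)) (by norm_num)

/-! ### Large arguments and conclusion -/

theorem abs_sumDk_four_sub_le_of_ge {x : ℝ} (hx : 112 ≤ x) :
    |sumDk 4 x - (C₁ * x * Real.log x ^ 3 + C₂ * x * Real.log x ^ 2
      + C₃ * x * Real.log x + C₄ * x)| ≤ 4.48 * x ^ (3 / 4 : ℝ) * Real.log x := by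
  have hx0 : 0 ≤ x := by linarith
  obtain ⟨y, hy0, rfl⟩ : ∃ y, 0 ≤ y ∧ x = y ^ 4 := by
    refine ⟨x ^ (1 / 4 : ℝ), by positivity, ?_⟩
    rw [← Real.rpow_natCast, ← Real.rpow_mul hx0]
    norm_num
  -- The threshold 112 is just above `3.25⁴`.
  have hy : 3.25 ≤ y := by
    refine le_of_pow_le_pow_left₀ (n := 4) (by norm_num) hy0 ?_
    norm_num
    linarith
  have hpow : (y ^ 4) ^ (3 / 4 : ℝ) = y ^ 3 := by
    rw [← Real.rpow_natCast y 4, ← Real.rpow_mul hy0, ← Real.rpow_natCast y 3]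
    norm_num
  have hlog : Real.log (y ^ 4) = 4 * Real.log y := by
    rw [Real.log_pow]
    norm_num
  have hL : 4.7 ≤ 4 * Real.log y := by
    rw [← hlog]
    refine le_trans ?_ (Real.log_le_log (by norm_num) hx)
    exact_mod_cast le_log_of_smooth (n := 112) (lo := 4.7) 112 4 0 0 1 (by norm_num) le_rfl (by norm_num)
  have h := abs_sumDk_four_sub_le (y := y) (by linarith)
  rw [hpow, hlog]
  obtain ⟨g1, g2⟩ := eulerMascheroniConstant_bounds
  generalize 4 * Real.log y = L at *
  rw [show C₁ * y ^ 4 * L ^ 3 + C₂ * y ^ 4 * L ^ 2 + C₃ * y ^ 4 * L + C₄ * y ^ 4 =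
    y ^ 4 * (C₁ * L ^ 3 + C₂ * L ^ 2 + C₃ * L + C₄) by ring]
  refine h.trans ?_
  -- Replacing the constant 4 by 4.48 and using `4γ - 4 ≤ -1.69` leaves room `y³ (0.48 L + 6.76)`,
  -- with `6.76 = 4 · 1.69`. It has to absorb the terms of order `y² L` and below.
  have k1 : L + 23.5 + 0.5 ≤ y * (0.48 * L + 6.76) := by nlinarith
  have k2 : y + 19 / 16 ≤ y ^ 2 * 0.5 := by nlinarith
  have k3 := mul_le_mul_of_nonneg_left k1 (sq_nonneg y)
  have k4 : y ^ 2 * (L - 2 * Real.eulerMascheroniConstant + 24.5) ≤ y ^ 2 * (L + 23.5) :=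
    mul_le_mul_of_nonneg_left (by linarith) (sq_nonneg y)
  have k5 : 4 * y ^ 3 * (L + 4 * Real.eulerMascheroniConstant - 4) ≤ 4 * y ^ 3 * (L - 1.69) :=
    mul_le_mul_of_nonneg_left (by linarith) (by positivity)
  linarith

theorem abs_sumDk_four_sub_le_rpow {x : ℝ} (hx : 2 ≤ x) :
    |sumDk 4 x - (C₁ * x * Real.log x ^ 3 + C₂ * x * Real.log x ^ 2
      + C₃ * x * Real.log x + C₄ * x)| ≤ 4.48 * x ^ (3 / 4 : ℝ) * Real.log x :=
  (lt_or_ge x 112).elim (abs_sumDk_four_sub_le_of_lt hx) abs_sumDk_four_sub_le_of_ge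

theorem sumDk_four_le_of_ge {x : ℝ} (hx : 408 ≤ x) : sumDk 4 x ≤ 1 / 3 * x * Real.log x ^ 3 := by
  have hx0 : 0 < x := by linarith
  have hL : 6 ≤ Real.log x := by
    refine le_trans ?_ (Real.log_le_log (by norm_num) hx)
    exact_mod_cast le_log_of_smooth (n := 408) (lo := 6) 405 0 4 1 0 (by norm_num) (by norm_num)
      (by norm_num)
  have h := (abs_le.1 (abs_sumDk_four_sub_le_rpow (x := x) (by linarith))).2
  -- The threshold 408 exceeds both `4.48⁴ ≈ 402.8` and `e⁶ ≈ 403.4`: the first bounds the error by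
  -- `x log x`, the second gives `L ≥ 6`.
  have hpow : 4.48 * x ^ (3 / 4 : ℝ) ≤ x := by
    have e : x ^ (3 / 4 : ℝ) * x ^ (1 / 4 : ℝ) = x := by
      rw [← Real.rpow_add hx0]
      norm_num
    have h4 : 4.48 ≤ x ^ (1 / 4 : ℝ) := by
      have : ((4.48 : ℝ) ^ 4) ^ (1 / 4 : ℝ) ≤ x ^ (1 / 4 : ℝ) :=
        Real.rpow_le_rpow (by positivity) (le_trans (by norm_num) hx) (by norm_num)
      rwa [← Real.rpow_natCast _ 4, ← Real.rpow_mul (by norm_num),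
        show ((4 : ℕ) : ℝ) * (1 / 4) = 1 by norm_num, Real.rpow_one] at this
    have hp : 0 < x ^ (3 / 4 : ℝ) := by positivity
    nlinarith
  obtain ⟨⟨-, c2⟩, ⟨-, c3⟩, ⟨-, c4⟩⟩ := constants_mem
  set L := Real.log x
  have hE : 4.48 * x ^ (3 / 4 : ℝ) * L ≤ x * L := mul_le_mul_of_nonneg_right hpow (by linarith)
  have hpoly : C₁ * L ^ 3 + C₂ * L ^ 2 + C₃ * L + C₄ + L ≤ 1 / 3 * L ^ 3 := by
    unfold C₁
    have t2 := mul_le_mul_of_nonneg_right c2.le (sq_nonneg L)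
    have t3 := mul_le_mul_of_nonneg_right c3.le (by linarith : 0 ≤ L)
    -- Nearly tight at `L = 6`, where the left side is about 35.75 and the right side 36.
    have key : 0.655 * L ^ 2 + 1.982 * L + 0.273 ≤ 1 / 6 * L ^ 3 := by
      nlinarith [mul_nonneg (sub_nonneg.2 hL) (sq_nonneg L), mul_nonneg (sub_nonneg.2 hL) (sub_nonneg.2 hL)]
    linarith
  have := mul_le_mul_of_nonneg_left hpoly hx0.le
  linarith

theorem theorem1 :
    (∀ x : ℝ, 2 ≤ x →
      |sumDk 4 x - (C₁ * x * Real.log x ^ 3 + C₂ * x * Real.log x ^ 2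
          + C₃ * x * Real.log x + C₄ * x)|
        ≤ 4.48 * x ^ (3 / 4 : ℝ) * Real.log x) ∧
    (C₂ ∈ Set.Ico (0.654 : ℝ) 0.655 ∧ C₃ ∈ Set.Ico (0.981 : ℝ) 0.982 ∧
      C₄ ∈ Set.Ico (0.272 : ℝ) 0.273) ∧
    (∀ x : ℝ, 193 ≤ x → sumDk 4 x ≤ 1 / 3 * x * Real.log x ^ 3) :=
  ⟨fun _ hx => abs_sumDk_four_sub_le_rpow hx, constants_mem, fun x hx =>
    (lt_or_ge x 408).elim (sumDk_four_le_of_lt hx) sumDk_four_le_of_ge⟩
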